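/- Let $F$ be a free group of finite rank with free basis $A=\{a_1,\dots,a_r\}$. For $g\in F$ let $|g|$ be the least length of a word in $A\cup A^{-1}$ that represents $g$, and let $d_A(g,h)=|g^{-1}h|$ be the word metric on $F$. Then the closest element problem in $F$ is solvable in polynomial time. That is, there is a (multi-tape, or multi-stack) Turing machine that, given words in $A\cup A^{-1}$ (not necessarily reduced) representing elements $g,h_1,\dots,h_n\in F$, where $n\ge 0$ is part of the input, outputs, in a number of steps bounded by a polynomial in the input length, a word in $A\cup A^{-1}$ representing an element $h\in H=\langle h_1,\dots,h_n\rangle$ with $d_A(g,h)\le d_A(g,h')$ for all $h'\in H$. The group $F$ and its basis are fixed (the machine and the polynomial may depend on $r$), and the input length is $|g|_{\mathrm{word}}+\sum_i|h_i|_{\mathrm{word}}+n+1$, where $|\cdot|_{\mathrm{word}}$ is the length of the given word (each word is written down followed by a separator). -/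

import Mathlib

namespace ClosestElement

/-- Words in the alphabet `A ∪ A⁻¹`: the letter `(a, true)` stands for `a` and the letter
`(a, false)` for `a⁻¹`. Words need not be freely reduced. -/
abbrev Word (A : Type) : Type := List (A × Bool)

section Group

variable {A : Type} {G : Type*} [Group G]

/-- The element of `G` represented by a word, where `x : A → G` gives the generators. -/
def eval (x : A → G) (w : Word A) : G :=
  (w.map fun p => if p.2 then x p.1 else (x p.1)⁻¹).prod

/-- The word length of `g`: the least length of a word in the generators and their inverses
that represents `g`. (Meant for `x` whose range generates `G`, so that such a word exists.) -/
noncomputable def wordLength (x : A → G) (g : G) : ℕ :=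
  sInf {n | ∃ w : Word A, eval x w = g ∧ w.length = n}

/-- The (left-invariant) word metric on `G` with respect to the generators `x`. -/
noncomputable def wordDist (x : A → G) (g h : G) : ℕ :=
  wordLength x (g⁻¹ * h)

end Group

/-- An instance of the closest element problem: a word for the element `g`, and a finite list of
words for the generators of the subgroup `H`. -/
structure Instance (A : Type) where
  /-- the word that represents the element -/
  elt : Word A
  /-- the words that represent the generators of the subgroup -/
  gens : List (Word A)

/-- An instance `(g; h₁, …, hₙ)` is written on the tape as `g # h₁ # ⋯ hₙ #`; the separator `#` is
`none`. -/
def Instance.encode {A : Type} (I : Instance A) : List (Option (A × Bool)) :=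
  (I.elt :: I.gens).flatMap fun w => w.map some ++ [none]

section Group

variable {A : Type} {G : Type*} [Group G]

/-- The subgroup `H = ⟨h₁, …, hₙ⟩` of `G` given by an instance. -/
def Instance.subgroup (x : A → G) (I : Instance A) : Subgroup G :=
  Subgroup.closure {h | ∃ w ∈ I.gens, eval x w = h}

/-- The word `w` represents an element of `H` that is closest to `g` in the word metric, among all
the elements of `H`. -/
def IsSolution (x : A → G) (I : Instance A) (w : Word A) : Prop :=
  eval x w ∈ I.subgroup x ∧
    ∀ h ∈ I.subgroup x, wordDist x (eval x I.elt) (eval x w) ≤ wordDist x (eval x I.elt) h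

/-- The closest element problem in the fixed group `G` with the fixed generators `x` is solvable in
polynomial time: some function that is computed by a (multi-stack) Turing machine, in a number of
steps bounded by a polynomial in the length of the encoded instance, sends every instance to a
word for a closest element. -/
def SolvableInPolyTime (x : A → G) : Prop :=
  ∃ f : Instance A → Word A,
    Nonempty (Turing.TM2ComputableInPolyTime (Instance.encode (A := A)) (fun w : Word A => w) f) ∧
      ∀ I : Instance A, IsSolution x I (f I)

end Group

end ClosestElement

namespace ClosestElement

open Turing Function StateTransition

/-! ### Bounded-loop programs on stacks -/

/-! The mathematics is Stallings folding. Write the input as one string `x`. Its `n = |x| + 1`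
positions are the vertices of a graph, in which a letter `y` at position `p` gives an edge from `p`
to `p + 1` labelled `y`, together with the inverse edge. The first word `g` becomes a path from
vertex `0` to vertex `|g|`. Identifying both ends of every other word with `0` turns these words
into loops at `0`. Let `E` be the least transitive relation on the vertices that contains these
identifications and relates the ends of equally labelled edges whose origins are related.

Give each position the value in `G` of the letters since the last separator. Related vertices have
values in the same right coset of `H`, so a path from `|g|` to `0` labelled `u` satisfies `g u ∈ H`
(`IsFolded.mul_inv_mem`, `IsFolded.mul_eval_mem`). Conversely, every `h' ∈ H` labels a loop at `0`
(`IsFolded.exists_reach`), so some word for `g⁻¹ h'` labels a path from `|g|` to `0`. Because the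
graph is folded, a subword `y y⁻¹` can be cut out of a path label (`Reach.cancel`), and the reduced
word for `g⁻¹ h'` labels such a path as well. In a free group the length of that word is `d(g, h')`.
Hence if `u` is a shortest label from `|g|` to `0`, then `g u` is a closest element
(`algorithm_isSolution`). Folding can relate at most `n²` pairs, and breadth-first search needs
fewer than `n` steps because `g⁻¹` already labels a path.

For the time bound, the algorithm is written in a language of array programs (`Cmd`) whose only loop
repeats a body exactly `n` times. It is translated to stack programs (`Prog`) by `Rep.compile`, and
these to machine code by `Prog.code_reachesIn`. The number of machine steps is then a polynomial
read off the syntax (`Prog.cost`), so no run of the algorithm has to be timed separately. -/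

/-- Programs that act on a family of stacks over the alphabet `Γ`, indexed by `R`. The number of
iterations of every loop is the same global parameter. -/
inductive Prog (R Γ : Type) : Type
  | skip : Prog R Γ
  | push : R → Γ → Prog R Γ
  | pop : R → Prog R Γ
  | case : R → (Option Γ → Prog R Γ) → Prog R Γ
  | seq : Prog R Γ → Prog R Γ → Prog R Γ
  | loop : Prog R Γ → Prog R Γ

namespace Prog

variable {R Γ : Type}

/-- The effect of a program on the stacks, where each loop is repeated `n` times. -/
def run [DecidableEq R] (n : ℕ) : Prog R Γ → (R → List Γ) → R → List Γ
  | skip, S => S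
  | push k a, S => update S k (a :: S k)
  | pop k, S => update S k (S k).tail
  | case k f, S => run n (f (S k).head?) S
  | seq P Q, S => run n Q (run n P S)
  | loop P, S => (run n P)^[n] S

/-- A bound for the number of machine steps, as a polynomial in the loop parameter. -/
noncomputable def cost [Fintype Γ] : Prog R Γ → Polynomial ℕ
  | skip => 1
  | push _ _ => 1
  | pop _ => 1
  | case _ f => 1 + ∑ o, cost (f o)
  | seq P Q => cost P + cost Q
  -- Each round costs the body and one test at the loop head. Then come one failing test and `n + 1`
  -- steps that refill the counter.
  | loop P => Polynomial.X * (cost P + 1) + 1 + (Polynomial.X + 1)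

/-- A unit of cost pushes at most one symbol on a stack. The bound limits both the length of the
output and the time needed to empty the stacks at the end. -/
theorem length_run_le [DecidableEq R] [Fintype Γ] (n : ℕ) (P : Prog R Γ) :
    ∀ (S : R → List Γ) (k : R), (P.run n S k).length ≤ (S k).length + P.cost.eval n := by
  induction P with
  | skip => intro S k; simp [run, cost]
  | push r a =>
    intro S k
    rcases eq_or_ne k r with rfl | h <;> simp [run, cost, *]
  | pop r =>
    intro S k
    rcases eq_or_ne k r with rfl | h <;> simp [run, cost, *]
    omega
  | case r f ih =>
    intro S k
    have h1 := ih (S r).head? S k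
    have h2 : (f (S r).head?).cost.eval n ≤ ∑ o, (f o).cost.eval n :=
      Finset.single_le_sum (f := fun o => (f o).cost.eval n) (fun _ _ => Nat.zero_le _)
        (Finset.mem_univ _)
    simp only [run, cost, Polynomial.eval_add, Polynomial.eval_one, Polynomial.eval_finsetSum]
    omega
  | seq P Q ihP ihQ =>
    intro S k
    have h1 := ihP S k
    have h2 := ihQ (P.run n S) k
    simp only [run, cost, Polynomial.eval_add]
    omega
  | loop P ih =>
    intro S k
    have key : ∀ m, ((P.run n)^[m] S k).length ≤ (S k).length + m * P.cost.eval n := by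
      intro m
      induction m with
      | zero => simp
      | succ m ihm =>
        rw [iterate_succ_apply']
        have := ih ((P.run n)^[m] S) k
        rw [Nat.succ_mul]
        omega
    have := key n
    simp only [run, cost, Polynomial.eval_add, Polynomial.eval_mul, Polynomial.eval_X,
      Polynomial.eval_one, mul_add]
    omega

/-- The labels of the machine code of a program. -/
def Lab : Prog R Γ → Type
  | skip => Unit
  | push _ _ => Unit
  | pop _ => Unit
  | case _ f => Option (Σ o, Lab (f o))
  | seq P Q => Lab P ⊕ Lab Q
  | loop P => Bool ⊕ Lab P

theorem finite_lab [Finite Γ] (P : Prog R Γ) : Finite P.Lab := by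
  induction P with
  | skip => exact inferInstanceAs (Finite Unit)
  | push _ _ => exact inferInstanceAs (Finite Unit)
  | pop _ => exact inferInstanceAs (Finite Unit)
  | case k f ih => exact inferInstanceAs (Finite (Option (Σ o, Lab (f o))))
  | seq P Q ihP ihQ => exact inferInstanceAs (Finite (Lab P ⊕ Lab Q))
  | loop P ih => exact inferInstanceAs (Finite (Bool ⊕ Lab P))

/-- The label at which the machine code of a program starts. -/
def entry : (P : Prog R Γ) → P.Lab
  | skip => ()
  | push _ _ => ()
  | pop _ => ()
  | case _ _ => none
  | seq P _ => .inl (entry P)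
  | loop _ => .inl false

end Prog

/-! ### Stacks of the machine -/

/-- The stacks of the machine: input and output (`inl false`, `inl true`), the stacks of the
program, and two counters for each label. -/
abbrev StkIdx (R Λ : Type) : Type := Bool ⊕ (R ⊕ Λ × Bool)

/-- The alphabets of the stacks. -/
def StkSym (I O Γ R Λ : Type) : StkIdx R Λ → Type
  | .inl false => I
  | .inl true => O
  | .inr _ => Γ

variable {I O Γ R Λ : Type}

/-- The family of stacks with given contents. -/
def mkStk (i : List I) (o : List O) (Z : R ⊕ Λ × Bool → List Γ) :
    ∀ k, List (StkSym I O Γ R Λ k)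
  | .inl false => i
  | .inl true => o
  | .inr k => Z k

section Update

variable [DecidableEq R] [DecidableEq Λ]

theorem update_mkStk_inp (i i' : List I) (o : List O) (Z : R ⊕ Λ × Bool → List Γ) :
    update (mkStk i o Z) (.inl false) i' = mkStk i' o Z := by
  funext k
  rcases k with (_ | _) | k
  · exact update_self _ _ _
  · exact update_of_ne (by simp) _ _
  · exact update_of_ne (by simp) _ _

theorem update_mkStk_out (i : List I) (o o' : List O) (Z : R ⊕ Λ × Bool → List Γ) :
    update (mkStk i o Z) (.inl true) o' = mkStk i o' Z := by
  funext k
  rcases k with (_ | _) | k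
  · exact update_of_ne (by simp) _ _
  · exact update_self _ _ _
  · exact update_of_ne (by simp) _ _

theorem update_mkStk_inr (i : List I) (o : List O) (Z : R ⊕ Λ × Bool → List Γ)
    (k : R ⊕ Λ × Bool) (l : List Γ) :
    update (mkStk i o Z) (.inr k) l = mkStk i o (update Z k l) := by
  funext k'
  rcases k' with (_ | _) | k'
  · exact update_of_ne (by simp) _ _
  · exact update_of_ne (by simp) _ _
  · rcases eq_or_ne k' k with rfl | h
    · exact (update_self _ _ _).trans (update_self k' l Z).symm
    · have e : update Z k l k' = Z k' := update_of_ne h _ _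
      exact (update_of_ne (by simpa using h) _ _).trans e.symm

end Update

/-- Statements of the machine. The internal state holds the symbol that was read last. -/
abbrev MStmt (I O Γ R Λ : Type) : Type := TM2.Stmt (StkSym I O Γ R Λ) Λ (Option Γ)

namespace MStmt

/-- Push a symbol on an inner stack. -/
def push (k : R ⊕ Λ × Bool) (a : Option Γ → Γ) (q : MStmt I O Γ R Λ) : MStmt I O Γ R Λ :=
  TM2.Stmt.push (Γ := StkSym I O Γ R Λ) (.inr k) a q

/-- Pop a symbol from an inner stack. -/
def pop (k : R ⊕ Λ × Bool) (f : Option Γ → Option Γ → Option Γ) (q : MStmt I O Γ R Λ) :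
    MStmt I O Γ R Λ :=
  TM2.Stmt.pop (Γ := StkSym I O Γ R Λ) (.inr k) f q

/-- Read the top symbol of an inner stack. -/
def peek (k : R ⊕ Λ × Bool) (f : Option Γ → Option Γ → Option Γ) (q : MStmt I O Γ R Λ) :
    MStmt I O Γ R Λ :=
  TM2.Stmt.peek (Γ := StkSym I O Γ R Λ) (.inr k) f q

/-- Pop a symbol from the input stack. -/
def popInp (f : Option Γ → Option I → Option Γ) (q : MStmt I O Γ R Λ) : MStmt I O Γ R Λ :=
  TM2.Stmt.pop (Γ := StkSym I O Γ R Λ) (.inl false) f q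

/-- Push a symbol on the output stack. -/
def pushOut (a : Option Γ → O) (q : MStmt I O Γ R Λ) : MStmt I O Γ R Λ :=
  TM2.Stmt.push (Γ := StkSym I O Γ R Λ) (.inl true) a q

variable [DecidableEq R] [DecidableEq Λ] (i : List I) (o : List O) (Z : R ⊕ Λ × Bool → List Γ)
  (q : MStmt I O Γ R Λ) (v : Option Γ) (k : R ⊕ Λ × Bool)

@[simp]
theorem stepAux_push (a : Option Γ → Γ) :
    TM2.stepAux (push k a q) v (mkStk i o Z) =
      TM2.stepAux q v (mkStk i o (update Z k (a v :: Z k))) := by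
  rw [← update_mkStk_inr]
  rfl

@[simp]
theorem stepAux_pop (f : Option Γ → Option Γ → Option Γ) :
    TM2.stepAux (pop k f q) v (mkStk i o Z) =
      TM2.stepAux q (f v (Z k).head?) (mkStk i o (update Z k (Z k).tail)) := by
  rw [← update_mkStk_inr]
  rfl

@[simp]
theorem stepAux_peek (f : Option Γ → Option Γ → Option Γ) :
    TM2.stepAux (peek k f q) v (mkStk i o Z) = TM2.stepAux q (f v (Z k).head?) (mkStk i o Z) :=
  rfl

@[simp]
theorem stepAux_popInp (f : Option Γ → Option I → Option Γ) :
    TM2.stepAux (popInp f q) v (mkStk i o Z) =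
      TM2.stepAux q (f v i.head?) (mkStk i.tail o Z) := by
  rw [← update_mkStk_inp i i.tail]
  rfl

@[simp]
theorem stepAux_pushOut (a : Option Γ → O) :
    TM2.stepAux (pushOut a q) v (mkStk i o Z) =
      TM2.stepAux q v (mkStk i (a v :: o) Z) := by
  rw [← update_mkStk_out i o (a v :: o)]
  rfl

end MStmt

/-! ### Timed runs, and the simulation of programs by machine code. -/

/-- `f` leads from `a` to `b` in at most `t` steps. -/
def ReachesIn {σ : Type*} (f : σ → Option σ) (t : ℕ) (a b : σ) : Prop :=
  Nonempty (EvalsToInTime f a (some b) t)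

namespace ReachesIn

variable {σ : Type*} {f : σ → Option σ} {a b c : σ} {s t : ℕ}

theorem refl (a : σ) : ReachesIn f 0 a a := ⟨EvalsToInTime.refl f a⟩

theorem mono (h : ReachesIn f s a b) (hst : s ≤ t) : ReachesIn f t a b :=
  h.elim fun e => ⟨⟨e.toEvalsTo, e.steps_le_m.trans hst⟩⟩

theorem trans (h₁ : ReachesIn f s a b) (h₂ : ReachesIn f t b c) : ReachesIn f (s + t) a c :=
  h₁.elim fun e₁ => h₂.elim fun e₂ => by
    rw [add_comm]
    exact ⟨EvalsToInTime.trans f s t a b (some c) e₁ e₂⟩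

theorem single (h : f a = some b) : ReachesIn f 1 a b :=
  ⟨⟨⟨1, by simpa [flip] using h⟩, le_rfl⟩⟩

theorem head (h : f a = some b) (h₂ : ReachesIn f t b c) : ReachesIn f (t + 1) a c := by
  rw [add_comm]
  exact (single h).trans h₂

end ReachesIn

namespace Prog

/-- The machine code of a program inside a machine with labels `Λ`: the labels of the program are
embedded by `emb`, and control passes to `exit` at the end. The stacks `(l, false)` and `(l, true)`
are the counters of the loop with label `l`. -/
def code [Inhabited Γ] (I O : Type) : (P : Prog R Γ) → (P.Lab → Λ) → Λ → P.Lab → MStmt I O Γ R Λ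
  | skip, _, exit, _ => .goto fun _ => exit
  | push k a, _, exit, _ => MStmt.push (.inl k) (fun _ => a) (.goto fun _ => exit)
  | pop k, _, exit, _ => MStmt.pop (.inl k) (fun v _ => v) (.goto fun _ => exit)
  | case k f, emb, _, none =>
    MStmt.peek (.inl k) (fun _ o => o) (.goto fun v => emb (some ⟨v, entry (f v)⟩))
  | case _ f, emb, exit, some ⟨o, l⟩ => code I O (f o) (fun l => emb (some ⟨o, l⟩)) exit l
  | seq P Q, emb, _, .inl l =>
    code I O P (fun l => emb (.inl l)) (emb (.inr (entry Q))) l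
  | seq _ Q, emb, exit, .inr l => code I O Q (fun l => emb (.inr l)) exit l
  | loop P, emb, _, .inl false =>
    MStmt.pop (.inr (emb (.inl false), false)) (fun _ o => o) <|
      .branch Option.isSome
        (MStmt.push (.inr (emb (.inl false), true)) (fun _ => (default : Γ))
          (.goto fun _ => emb (.inr (entry P))))
        (.goto fun _ => emb (.inl true))
  | loop _, emb, exit, .inl true =>
    MStmt.pop (.inr (emb (.inl false), true)) (fun _ o => o) <|
      .branch Option.isSome
        (MStmt.push (.inr (emb (.inl false), false)) (fun _ => (default : Γ))
          (.goto fun _ => emb (.inl true)))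
        (.goto fun _ => exit)
  | loop P, emb, _, .inr l => code I O P (fun l => emb (.inr l)) (emb (.inl false)) l

/-- The invariant is that the two counters of every label hold `n` tokens and none. A loop consumes
its own counter and refills it before leaving, so the same counter family `c` stands at entry and
exit. This lets an inner loop run again in the next round of an outer one. Injectivity of `emb`
keeps the counters of different loops apart. -/
theorem code_reachesIn [Inhabited Γ] [Fintype Γ] [DecidableEq R] [DecidableEq Λ]
    (M : Λ → MStmt I O Γ R Λ) (n : ℕ) (i : List I) (o : List O) (P : Prog R Γ) :
    ∀ (emb : P.Lab → Λ) (exit : Λ), Injective emb → (∀ l, M (emb l) = P.code I O emb exit l) →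
    ∀ (S : R → List Γ) (c : Λ × Bool → List Γ),
      (∀ l, c (emb l, false) = List.replicate n default ∧ c (emb l, true) = []) →
      ∀ v, ∃ v', ReachesIn (TM2.step M) (P.cost.eval n)
        ⟨some (emb P.entry), v, mkStk i o (Sum.elim S c)⟩
        ⟨some exit, v', mkStk i o (Sum.elim (P.run n S) c)⟩ := by
  induction P with
  | skip =>
    intro emb exit _ hM S c _ v
    refine ⟨v, ?_⟩
    simp only [cost, Polynomial.eval_one]
    exact .single (by simp [-Sum.elim_update_left, -Sum.elim_update_right, hM, code, run])
  | push k a =>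
    intro emb exit _ hM S c _ v
    refine ⟨v, ?_⟩
    simp only [cost, Polynomial.eval_one]
    exact .single (by simp [-Sum.elim_update_left, -Sum.elim_update_right, hM, code, run])
  | pop k =>
    intro emb exit _ hM S c _ v
    refine ⟨v, ?_⟩
    simp only [cost, Polynomial.eval_one]
    exact .single (by simp [-Sum.elim_update_left, -Sum.elim_update_right, hM, code, run])
  | case k f ih =>
    intro emb exit hemb hM S c hc v
    obtain ⟨v', hv'⟩ := ih (S k).head? (fun l => emb (some ⟨_, l⟩)) exit
      (fun a b hab => by cases hemb hab; rfl) (fun l => hM (some ⟨_, l⟩)) S c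
      (fun l => hc (some ⟨_, l⟩)) (S k).head?
    refine ⟨v', ?_⟩
    have h2 : (f (S k).head?).cost.eval n ≤ ∑ o, (f o).cost.eval n :=
      Finset.single_le_sum (f := fun o => (f o).cost.eval n) (fun _ _ => Nat.zero_le _)
        (Finset.mem_univ _)
    refine (ReachesIn.head ?_ hv').mono ?_
    · have e : M (emb (case k f).entry) = _ := hM none
      simp [e, code]
    · simp only [cost, Polynomial.eval_add, Polynomial.eval_one, Polynomial.eval_finsetSum]
      omega
  | seq P Q ihP ihQ =>
    intro emb exit hemb hM S c hc v
    obtain ⟨v₁, h₁⟩ := ihP (fun l => emb (.inl l)) (emb (.inr (entry Q)))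
      (fun a b hab => Sum.inl_injective (hemb hab)) (fun l => hM (.inl l)) S c
      (fun l => hc (.inl l)) v
    obtain ⟨v₂, h₂⟩ := ihQ (fun l => emb (.inr l)) exit
      (fun a b hab => Sum.inr_injective (hemb hab)) (fun l => hM (.inr l)) (P.run n S) c
      (fun l => hc (.inr l)) v₁
    refine ⟨v₂, ?_⟩
    simp only [cost, Polynomial.eval_add]
    exact h₁.trans h₂
  | loop P ih =>
    intro emb exit hemb hM S c hc v
    obtain ⟨z, hz⟩ : ∃ z, z = emb (.inl false) := ⟨_, rfl⟩
    -- Counter contents during the loop: `a` rounds are still to come and `b` tokens are parked on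
    -- the auxiliary stack; all other counters are as in `c`.
    let ctr (a b : ℕ) : Λ × Bool → List Γ :=
      update (update c (z, false) (List.replicate a default)) (z, true) (List.replicate b default)
    have hctr0 : ctr n 0 = c := by
      have h1 := (hc (.inl false)).1
      have h2 := (hc (.inl false)).2
      simp only [ctr, hz, ← h1, List.replicate_zero, ← h2, update_eq_self]
    have hMf : M z = MStmt.pop (.inr (z, false)) (fun _ o => o) (.branch Option.isSome
        (MStmt.push (.inr (z, true)) (fun _ => default) (.goto fun _ => emb (.inr (entry P))))
        (.goto fun _ => emb (.inl true))) := hz ▸ hM (.inl false)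
    have hMt : M (emb (.inl true)) = MStmt.pop (.inr (z, true)) (fun _ o => o)
        (.branch Option.isSome
          (MStmt.push (.inr (z, false)) (fun _ => default) (.goto fun _ => emb (.inl true)))
          (.goto fun _ => exit)) := hz ▸ hM (.inl true)
    have iter : ∀ m k S v, ∃ v', ReachesIn (TM2.step M) (m * (P.cost.eval n + 1))
        ⟨some z, v, mkStk i o (Sum.elim S (ctr m k))⟩
        ⟨some z, v', mkStk i o (Sum.elim ((P.run n)^[m] S) (ctr 0 (k + m)))⟩ := by
      intro m
      induction m with
      | zero => intro k S v; exact ⟨v, by simpa using ReachesIn.refl _⟩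
      | succ m ihm =>
        intro k S v
        obtain ⟨v₁, h₁⟩ := ih (fun l => emb (.inr l)) z
          (fun a b hab => Sum.inr_injective (hemb hab)) (fun l => hz ▸ hM (.inr l)) S
          (ctr m (k + 1)) (fun l => by
            -- The labels of the body differ from the loop head, so their counters are still full.
            have hne : emb (.inr l) ≠ z := fun e => by cases hemb (e.trans hz)
            simpa [ctr, hne] using hc (.inr l)) (some default)
        obtain ⟨v₂, h₂⟩ := ihm (k + 1) (P.run n S) v₁
        refine ⟨v₂, ?_⟩
        have h3 := (ReachesIn.head (f := TM2.step M)
          (a := ⟨some z, v, mkStk i o (Sum.elim S (ctr (m + 1) k))⟩) ?_ h₁).trans h₂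
        · rw [iterate_succ_apply, show k + (m + 1) = k + 1 + m by omega, Nat.succ_mul]
          exact h3.mono (by omega)
        · have e : update (update (ctr (m + 1) k) (z, false) (List.replicate m default))
              (z, true) (default :: List.replicate k default) = ctr m (k + 1) := by
            simp only [ctr]
            rw [update_comm (by simp) _ _ (update c _ _), update_idem, update_idem, List.replicate_succ]
          have e1 : ctr (m + 1) k (z, false) = default :: List.replicate m default := by
            simp [ctr, List.replicate_succ]
          have e2 : ctr (m + 1) k (z, true) = List.replicate k default := by
            simp [ctr]
          simp [-Sum.elim_update_left, -Sum.elim_update_right, hMf, e1, e2, e]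
    have restore : ∀ k m S v, ∃ v', ReachesIn (TM2.step M) (k + 1)
        ⟨some (emb (.inl true)), v, mkStk i o (Sum.elim S (ctr m k))⟩
        ⟨some exit, v', mkStk i o (Sum.elim S (ctr (m + k) 0))⟩ := by
      intro k
      induction k with
      | zero =>
        intro m S v
        refine ⟨none, .single ?_⟩
        have e2 : ctr m 0 (z, true) = [] := by simp [ctr]
        have e : update (ctr m 0) (z, true) [] = ctr m 0 := by simp [ctr]
        simp [-Sum.elim_update_left, -Sum.elim_update_right, hMt, e2, e]
      | succ k ihk =>
        intro m S v
        obtain ⟨v₁, h₁⟩ := ihk (m + 1) S (some default)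
        refine ⟨v₁, ?_⟩
        rw [show m + (k + 1) = m + 1 + k by omega]
        refine ReachesIn.head ?_ h₁
        have e1 : ctr m (k + 1) (z, true) = default :: List.replicate k default := by
          simp [ctr, List.replicate_succ]
        have e2 : ctr m (k + 1) (z, false) = List.replicate m default := by
          simp [ctr]
        have e : update (update (ctr m (k + 1)) (z, true) (List.replicate k default))
            (z, false) (default :: List.replicate m default) = ctr (m + 1) k := by
          simp only [ctr]
          rw [update_idem, update_comm (by simp), update_idem, List.replicate_succ]
        simp [-Sum.elim_update_left, -Sum.elim_update_right, hMt, e1, e2, e]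
    obtain ⟨v₁, h₁⟩ := iter n 0 S v
    obtain ⟨v₂, h₂⟩ := restore n 0 ((P.run n)^[n] S) none
    refine ⟨v₂, ?_⟩
    rw [hctr0, zero_add] at h₁
    rw [zero_add, hctr0] at h₂
    simp only [cost, Polynomial.eval_add, Polynomial.eval_mul, Polynomial.eval_X,
      Polynomial.eval_one]
    rw [show emb P.loop.entry = z from hz.symm]
    refine (h₁.trans (ReachesIn.single ?_)).trans h₂
    have e1 : ctr 0 n (z, false) = [] := by simp [ctr]
    have e : update (ctr 0 n) (z, false) [] = ctr 0 n := by
      simp only [ctr, List.replicate_zero]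
      rw [update_comm (by simp), update_idem]
    simp [-Sum.elim_update_left, -Sum.elim_update_right, hMf, e1, e]

end Prog

end ClosestElement

namespace ClosestElement

open Turing Function StateTransition

variable {I O Γ R Λ : Type}

/-! ### The machine that runs a bounded-loop program -/

namespace MStmt

/-- Add a token to the counters of all the labels in a list. -/
def tickAll [Inhabited Γ] (L : List Λ) (q : MStmt I O Γ R Λ) : MStmt I O Γ R Λ :=
  L.foldr (fun l q => push (.inr (l, false)) (fun _ => default) q) q

/-- Pop a symbol from all the stacks in a list, and keep one of these symbols, if there is one. -/
def popAll (L : List (R ⊕ Λ × Bool)) (q : MStmt I O Γ R Λ) : MStmt I O Γ R Λ :=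
  L.foldr (fun k q => pop k (fun v o => o.or v) q) q

open Classical in
/-- Push the symbol that was read last on the output stack. -/
noncomputable def output (outSym : Γ → Option O) (q : MStmt I O Γ R Λ) : MStmt I O Γ R Λ :=
  if h : Nonempty O then pushOut (fun v => (v.bind outSym).getD h.some) q else q

variable [DecidableEq R] [DecidableEq Λ]

theorem stepAux_output (outSym : Γ → Option O) (q : MStmt I O Γ R Λ) (x : O) (v : Option Γ)
    (h : v.bind outSym = some x) (i : List I) (o : List O) (Z : R ⊕ Λ × Bool → List Γ) :
    TM2.stepAux (output outSym q) v (mkStk i o Z) = TM2.stepAux q v (mkStk i (x :: o) Z) := by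
  simp [output, dif_pos (Nonempty.intro x), h]

theorem stepAux_tickAll [Inhabited Γ] (i : List I) (o : List O) (S : R → List Γ)
    (q : MStmt I O Γ R Λ) (v : Option Γ) (L : List Λ) (hL : L.Nodup) :
    ∀ c c' : Λ × Bool → List Γ, (∀ l, c' (l, true) = c (l, true)) →
      (∀ l ∉ L, c' (l, false) = c (l, false)) →
      (∀ l ∈ L, c' (l, false) = default :: c (l, false)) →
      TM2.stepAux (tickAll L q) v (mkStk i o (Sum.elim S c)) =
        TM2.stepAux q v (mkStk i o (Sum.elim S c')) := by
  induction L with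
  | nil =>
    intro c c' h1 h2 _
    have : c' = c := by
      funext ⟨l, b⟩
      cases b
      · exact h2 l (by simp)
      · exact h1 l
    rw [this]
    rfl
  | cons l L ih =>
    intro c c' h1 h2 h3
    obtain ⟨hl, hL'⟩ := List.nodup_cons.1 hL
    have e : tickAll (l :: L) q = push (.inr (l, false)) (fun _ => default) (tickAll L q) := rfl
    rw [e, stepAux_push, Sum.elim_inr, Sum.update_elim_inr]
    refine ih hL' _ _ (fun x => by simp [h1]) (fun x hx => ?_) fun x hx => ?_
    · rcases eq_or_ne x l with rfl | hne
      · simp [h3]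
      · simp [hne, h2 x (by simp [hx, hne])]
    · have hne : x ≠ l := fun e => hl (e ▸ hx)
      simp [hne, h3 x (by simp [hx])]

/-- The equivalence at the end turns the internal state into an emptiness test for all the stacks at
once, provided that the state was blank before. -/
theorem stepAux_popAll (i : List I) (o : List O) (q : MStmt I O Γ R Λ)
    (L : List (R ⊕ Λ × Bool)) (hL : L.Nodup) :
    ∀ (v : Option Γ) (Z Z' : R ⊕ Λ × Bool → List Γ), (∀ k ∉ L, Z' k = Z k) →
      (∀ k ∈ L, Z' k = (Z k).tail) → ∃ v',
      TM2.stepAux (popAll L q) v (mkStk i o Z) = TM2.stepAux q v' (mkStk i o Z') ∧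
      (v' = none ↔ v = none ∧ ∀ k ∈ L, Z k = []) := by
  induction L with
  | nil =>
    intro v Z Z' h1 _
    have : Z' = Z := funext fun k => h1 k (by simp)
    exact ⟨v, by rw [this]; rfl, by simp⟩
  | cons l L ih =>
    intro v Z Z' h1 h2
    obtain ⟨hl, hL'⟩ := List.nodup_cons.1 hL
    have e : popAll (l :: L) q = pop l (fun v o => o.or v) (popAll L q) := rfl
    have hne : ∀ k ∈ L, k ≠ l := fun k hk e => hl (e ▸ hk)
    obtain ⟨v', hv', hn⟩ := ih hL' ((Z l).head?.or v) (update Z l (Z l).tail) Z'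
      (fun x hx => by
        rcases eq_or_ne x l with rfl | hxl
        · simp [h2]
        · simp [hxl, h1 x (by simp [hx, hxl])])
      (fun x hx => by simp [hne x hx, h2 x (by simp [hx])])
    refine ⟨v', by rw [e, stepAux_pop, hv'], ?_⟩
    have e2 : (∀ k ∈ L, update Z l (Z l).tail k = []) ↔ ∀ k ∈ L, Z k = [] :=
      forall₂_congr fun k hk => by rw [update_of_ne (hne k hk)]
    rw [hn, Option.or_eq_none_iff, e2, List.head?_eq_none_iff, List.forall_mem_cons]
    tauto

end MStmt

section Machine

variable [Fintype Γ] [Inhabited Γ] [Fintype R] [DecidableEq R]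

noncomputable instance (P : Prog R Γ) : Fintype P.Lab :=
  have := P.finite_lab
  Fintype.ofFinite _

noncomputable instance (P : Prog R Γ) : DecidableEq P.Lab := Classical.decEq _

/-- The labels of the machine: loading the input, unloading the output, emptying the stacks, and
the labels of the program. -/
abbrev MLab (P : Prog R Γ) : Type := Fin 3 ⊕ P.Lab

/-- The code of the machine that runs a program. -/
noncomputable def machineCode (inSym : I → Γ) (outSym : Γ → Option O) (P : Prog R Γ)
    (rin rout : R) : MLab P → MStmt I O Γ R (MLab P)
  -- The counters are also increased in the round that finds the input exhausted, so they end at the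
  -- input length plus one, which becomes the loop parameter.
  | .inl 0 => MStmt.popInp (fun _ o => o.map inSym) <| MStmt.tickAll Finset.univ.toList <|
      .branch Option.isSome
        (MStmt.push (.inl rin) (fun v => v.getD default) (.goto fun _ => .inl 0))
        (.goto fun _ => .inr P.entry)
  | .inl 1 => MStmt.pop (.inl rout) (fun _ o => o) <|
      .branch Option.isSome
        (MStmt.output outSym (.goto fun _ => .inl 1))
        (.goto fun _ => .inl 2)
  | .inl 2 => MStmt.popAll Finset.univ.toList <|
      -- The state is blanked so that the next pass tests emptiness correctly.
      .branch Option.isSome (.load (fun _ => none) (.goto fun _ => .inl 2)) .halt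
  | .inr l => P.code I O Sum.inr (.inl 1) l

variable (inSym : I → Γ) (outSym : Γ → Option O) (P : Prog R Γ) (rin rout : R)

/-- The start value `m` of the counters is general for the induction. Moving the input from one
stack to another reverses it. -/
theorem load_reachesIn (i : List I) : ∀ (S : R → List Γ) (m : ℕ) (v : Option Γ),
    ReachesIn (TM2.step (machineCode inSym outSym P rin rout)) (i.length + 1)
      ⟨some (.inl 0), v, mkStk i [] (Sum.elim S fun x =>
        if x.2 = false then List.replicate m default else [])⟩
      ⟨some (.inr P.entry), none, mkStk [] [] (Sum.elim
        (update S rin (i.reverse.map inSym ++ S rin)) fun x =>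
          if x.2 = false then List.replicate (m + i.length + 1) default else [])⟩ := by
  have tick : ∀ (i : List I) (q : MStmt I O Γ R (MLab P)) (v : Option Γ) (S : R → List Γ) (m : ℕ),
      TM2.stepAux (MStmt.tickAll Finset.univ.toList q) v (mkStk i [] (Sum.elim S fun x =>
        if x.2 = false then List.replicate m default else [])) =
      TM2.stepAux q v (mkStk i [] (Sum.elim S fun x =>
        if x.2 = false then List.replicate (m + 1) default else [])) :=
    fun i q v S m => MStmt.stepAux_tickAll i [] S q v _ (Finset.nodup_toList _) _ _ (by simp)
      (by simp) (by simp [List.replicate_succ])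
  induction i with
  | nil =>
    intro S m v
    refine .single ?_
    simp only [TM2.step, machineCode, MStmt.stepAux_popInp, Option.some.injEq]
    rw [tick]
    simp [-Sum.elim_update_left]
  | cons x i ih =>
    intro S m v
    have h := ih (update S rin (inSym x :: S rin)) (m + 1) (some (inSym x))
    have e₁ : update (update S rin (inSym x :: S rin)) rin
        (i.reverse.map inSym ++ update S rin (inSym x :: S rin) rin) =
        update S rin ((x :: i).reverse.map inSym ++ S rin) := by simp
    have e₂ : m + 1 + i.length + 1 = m + (x :: i).length + 1 := by
      rw [List.length_cons]
      omega
    rw [e₁, e₂] at h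
    refine ReachesIn.head ?_ h
    simp only [TM2.step, machineCode, MStmt.stepAux_popInp, Option.some.injEq]
    rw [tick]
    simp [-Sum.elim_update_left, -Sum.elim_update_right]

theorem unload_reachesIn (osym : O → Γ) (hosym : ∀ x, outSym (osym x) = some x) (w : List O) :
    ∀ (o : List O) (S : R → List Γ) (c : MLab P × Bool → List Γ) (v : Option Γ),
    S rout = w.map osym →
    ReachesIn (TM2.step (machineCode inSym outSym P rin rout)) (w.length + 1)
      ⟨some (.inl 1), v, mkStk [] o (Sum.elim S c)⟩
      ⟨some (.inl 2), none, mkStk [] (w.reverse ++ o) (Sum.elim (update S rout []) c)⟩ := by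
  induction w with
  | nil =>
    intro o S c v hS
    refine .single ?_
    simp [machineCode, hS, -Sum.elim_update_left, -Sum.elim_update_right]
  | cons x w ih =>
    intro o S c v hS
    have h := ih (x :: o) (update S rout (w.map osym)) c (some (osym x)) (by simp)
    rw [update_idem] at h
    have e : (x :: w).reverse ++ o = w.reverse ++ x :: o := by simp
    rw [e]
    refine ReachesIn.head ?_ h
    have e' := MStmt.stepAux_output (I := I) (R := R) (Λ := MLab P) outSym
      (.goto fun _ => .inl 1) x (some (osym x)) (by simp [hosym]) [] o
      (Sum.elim (update S rout (w.map osym)) c)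
    simp [machineCode, hS, e', -Sum.elim_update_left, -Sum.elim_update_right]

/-- A halting configuration must have every stack except the output empty. One step pops all the
inner stacks in parallel, so the time is governed by the longest one. -/
theorem clean_reachesIn (o : List O) (m : ℕ) : ∀ (Z : R ⊕ MLab P × Bool → List Γ),
    (∀ k, (Z k).length ≤ m) →
    ReachesIn (TM2.step (machineCode inSym outSym P rin rout)) (m + 1)
      ⟨some (.inl 2), none, mkStk [] o Z⟩ ⟨none, none, mkStk [] o fun _ => []⟩ := by
  induction m with
  | zero =>
    intro Z hZ
    have hZ' : ∀ k, Z k = [] := fun k => List.length_eq_zero_iff.1 (Nat.le_zero.1 (hZ k))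
    refine .single ?_
    obtain ⟨v', h1, h2⟩ := MStmt.stepAux_popAll ([] : List I) o
      (.branch Option.isSome (.load (fun _ => none) (.goto fun _ => .inl 2)) .halt)
      Finset.univ.toList (Finset.nodup_toList _) none Z (fun _ => []) (by simp) (by simp [hZ'])
    rw [h2.2 ⟨rfl, fun k _ => hZ' k⟩] at h1
    simp [machineCode, h1]
  | succ m ih =>
    intro Z hZ
    obtain ⟨v', h1, h2⟩ := MStmt.stepAux_popAll ([] : List I) o
      (.branch Option.isSome (.load (fun _ => none) (.goto fun _ => .inl 2)) .halt)
      Finset.univ.toList (Finset.nodup_toList _) none Z (fun k => (Z k).tail) (by simp) (by simp)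
    cases v' with
    | none =>
      have hZ' : Z = fun _ => [] := funext fun k => (h2.1 rfl).2 k (by simp)
      subst hZ'
      exact (ih _ (by simp)).mono (by omega)
    | some a =>
      refine ReachesIn.head ?_ (ih (fun k => (Z k).tail) fun k => ?_)
      · simp [machineCode, h1]
      · have := hZ k
        simp only [List.length_tail]
        omega

/-- The bundled machine that runs a program. -/
noncomputable def machine [Fintype I] : FinTM2 where
  K := StkIdx R (MLab P)
  k₀ := .inl false
  k₁ := .inl true
  Γ := StkSym I O Γ R (MLab P)
  Λ := MLab P
  main := .inl 0
  σ := Option Γ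
  initialState := none
  Γk₀Fin := inferInstanceAs (Fintype I)
  m := machineCode inSym outSym P rin rout

theorem initList_machine [Fintype I] (i : List I) :
    initList (machine inSym outSym P rin rout) i =
      ⟨some (.inl 0), none, mkStk i [] fun _ => []⟩ := by
  unfold initList
  congr 1
  funext k
  rcases k with (_ | _) | k <;> rfl

theorem haltList_machine [Fintype I] (o : List O) :
    haltList (machine inSym outSym P rin rout) o = ⟨none, none, mkStk [] o fun _ => []⟩ := by
  unfold haltList
  congr 1
  funext k
  rcases k with (_ | _) | k <;> rfl

/-- A function that is computed by a bounded-loop program is computable in polynomial time. -/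
theorem Prog.computableInPolyTime [Fintype I] {α : Type} (ea : α → List I) (f : α → List O)
    (osym : O → Γ) (hosym : Injective osym) (hio : rin ≠ rout)
    (h : ∀ a, P.run ((ea a).length + 1)
      (update (fun _ => []) rin ((ea a).reverse.map inSym)) rout = (f a).reverse.map osym) :
    Nonempty (TM2ComputableInPolyTime ea (fun w : List O => w) f) := by
  let outSym : Γ → Option O := partialInv osym
  have hos : ∀ x, outSym (osym x) = some x := fun x => partialInv_left hosym x
  let T : Polynomial ℕ := P.cost.comp (Polynomial.X + 1)
  have hT : ∀ n, T.eval n = P.cost.eval (n + 1) := fun n => by simp [T]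
  refine ⟨⟨⟨machine inSym outSym P rin rout, Equiv.refl _, Equiv.refl _⟩,
    -- The summands are loading, running, unloading and cleaning. The output has length at most `T`,
    -- and before cleaning every inner stack has length at most `X + 1 + T`.
    (Polynomial.X + 1) + T + (T + 1) + (Polynomial.X + T + 2), fun a => Nonempty.some ?_⟩⟩
  let S₀ : R → List Γ := update (fun _ => []) rin ((ea a).reverse.map inSym)
  let n := (ea a).length + 1
  let c : MLab P × Bool → List Γ := fun x => if x.2 = false then List.replicate n default else []
  have h1 := load_reachesIn inSym outSym P rin rout (ea a) (fun _ => []) 0 none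
  have h1' : ReachesIn (TM2.step (machineCode inSym outSym P rin rout)) ((ea a).length + 1)
      ⟨some (.inl 0), none, mkStk (ea a) [] fun _ => []⟩
      ⟨some (.inr P.entry), none, mkStk [] [] (Sum.elim S₀ c)⟩ := by
    convert h1 using 3
    · funext k
      rcases k with k | k <;> simp
    · rw [List.append_nil, zero_add]
  obtain ⟨v, h2⟩ := Prog.code_reachesIn (machineCode inSym outSym P rin rout) n [] [] P Sum.inr
    (.inl 1) Sum.inr_injective (fun _ => rfl) S₀ c (fun l => by simp [c]) none
  have h3 := unload_reachesIn inSym outSym P rin rout osym hos (f a).reverse [] (P.run n S₀) c v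
    (h a)
  have hlen := fun k => Prog.length_run_le n P S₀ k
  have hS₀ : ∀ k, (S₀ k).length ≤ n := by
    intro k
    rcases eq_or_ne k rin with rfl | hk
    · simp [S₀, n]
    · simp [S₀, hk]
  -- Since `rin ≠ rout`, the output stack starts empty, so its final length is bounded by the cost
  -- alone.
  have hfa : (f a).length ≤ P.cost.eval n := by
    have := hlen rout
    erw [h a] at this
    simpa [S₀, hio.symm] using this
  have h4 := clean_reachesIn inSym outSym P rin rout ((f a).reverse.reverse ++ [])
    (n + P.cost.eval n) (Sum.elim (update (P.run n S₀) rout []) c) (by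
      rintro (k | k)
      · rcases eq_or_ne k rout with rfl | hk
        · simp
        · have h5 := hlen k
          have h6 := hS₀ k
          simp only [Sum.elim_inl, update_of_ne hk]
          omega
      · simp only [Sum.elim_inr, c]
        split_ifs <;> simp)
  have h5 := ((h1'.trans h2).trans h3).trans h4
  unfold TM2OutputsInTime
  have e1 : (ea a).map (Equiv.refl ((machine inSym outSym P rin rout).Γ
      (machine inSym outSym P rin rout).k₀)).invFun = ea a := List.map_id _
  have e2 : (f a).map (Equiv.refl ((machine inSym outSym P rin rout).Γ
      (machine inSym outSym P rin rout).k₁)).invFun = f a := List.map_id _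
  have h6 := h5.mono (t := ((Polynomial.X + 1) + T + (T + 1) + (Polynomial.X + T + 2)).eval
    (ea a).length) (by
      simp only [Polynomial.eval_add, hT, Polynomial.eval_X, Polynomial.eval_one,
        Polynomial.eval_ofNat, List.length_reverse]
      have e : n = (ea a).length + 1 := rfl
      rw [← e]
      omega)
  rw [List.reverse_reverse, List.append_nil] at h6
  have e3 := initList_machine inSym outSym P rin rout (ea a)
  have e4 := haltList_machine inSym outSym P rin rout (f a)
  erw [e1, e2, e3, Option.map_some, e4]
  exact h6

end Machine

end ClosestElement

namespace ClosestElement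

open Turing Function

/-! ### Programs on arrays -/

/-- The arrays and the output of a program on arrays. The output is kept in reverse order. -/
structure Store (Ar Γ : Type) where
  /-- the contents of the arrays -/
  arr : Ar → ℕ → Γ
  /-- the output, last symbol first -/
  out : List Γ

/-- Programs on arrays over `Γ`. A position in an array is given by a list of terms `(t, w)`, each
of which stands for `n ^ w` times the value of `t`, where `n` is the global loop parameter, `none`
has the value one, and `some v` is an index variable. -/
inductive Cmd (V Ar Γ : Type) : Type
  | skip : Cmd V Ar Γ
  | seq : Cmd V Ar Γ → Cmd V Ar Γ → Cmd V Ar Γ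
  | set : Ar → List (Option V × ℕ) → Γ → Cmd V Ar Γ
  | case : Ar → List (Option V × ℕ) → (Γ → Cmd V Ar Γ) → Cmd V Ar Γ
  | loop : V → Cmd V Ar Γ → Cmd V Ar Γ
  | emit : Γ → Cmd V Ar Γ

variable {V Ar Γ : Type}

/-- The value of a position expression. -/
def offset (n : ℕ) (env : V → ℕ) (e : List (Option V × ℕ)) : ℕ :=
  -- The cap at `n` reflects that a variable is counted down by a loop of only `n` rounds.
  (e.map fun t => n ^ t.2 * t.1.elim 1 fun v => min (env v) n).sum

/-- Change the entry number `i` of the array `a` to `x`. -/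
def Store.put [DecidableEq Ar] (s : Store Ar Γ) (a : Ar) (i : ℕ) (x : Γ) : Store Ar Γ where
  arr := update s.arr a (update (s.arr a) i x)
  out := s.out

@[simp]
theorem Store.put_arr [DecidableEq Ar] (s : Store Ar Γ) (a : Ar) (i : ℕ) (x : Γ) :
    (s.put a i x).arr = update s.arr a (update (s.arr a) i x) := rfl

@[simp]
theorem Store.put_out [DecidableEq Ar] (s : Store Ar Γ) (a : Ar) (i : ℕ) (x : Γ) :
    (s.put a i x).out = s.out := rfl

/-- The effect of a program on arrays. -/
def Cmd.exec [DecidableEq V] [DecidableEq Ar] (n : ℕ) :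
    Cmd V Ar Γ → (V → ℕ) → Store Ar Γ → Store Ar Γ
  | skip, _, s => s
  | seq P Q, env, s => exec n Q env (exec n P env s)
  | set a e x, env, s => s.put a (offset n env e) x
  | case a e f, env, s => exec n (f (s.arr a (offset n env e))) env s
  | loop v P, env, s =>
    (List.range n).foldl (fun s i => exec n P (update env v (env v + i)) s) s
  | emit x, _, s => { s with out := x :: s.out }

/-- The stacks that hold the data of a program on arrays: a pair of stacks for each index variable
and for each array, and the output. -/
abbrev Reg (V Ar : Type) : Type := Option ((V ⊕ Ar) × Bool)

/-- The stacks `S` hold the values `env` of the index variables, with auxiliary values `aux`, and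
the store `s`, where the array `a` is split at position `pos a`. -/
structure Rep [Inhabited Γ] (env aux : V → ℕ) (s : Store Ar Γ) (pos : Ar → ℕ)
    (S : Reg V Ar → List Γ) : Prop where
  var : ∀ v, S (some (.inl v, false)) = List.replicate (env v) default
  tmp : ∀ v, S (some (.inl v, true)) = List.replicate (aux v) default
  pos : ∀ a, (S (some (.inr a, true))).length = pos a
  arr : ∀ a i, ((S (some (.inr a, true))).reverse ++ S (some (.inr a, false))).getD i default =
    s.arr a i
  out : S none = s.out

namespace Prog

variable [Inhabited Γ]

/-- Move the split point of an array one step to the right. -/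
def moveRight (a : Ar) : Prog (Reg V Ar) Γ :=
  case (some (.inr a, false)) fun
    | none => push (some (.inr a, true)) default
    | some x => seq (pop (some (.inr a, false))) (push (some (.inr a, true)) x)

/-- Move the split point of an array one step to the left. -/
def moveLeft (a : Ar) : Prog (Reg V Ar) Γ :=
  case (some (.inr a, true)) fun
    | none => skip
    | some x => seq (pop (some (.inr a, true))) (push (some (.inr a, false)) x)

/-- Nested loops. -/
def loops (P : Prog (Reg V Ar) Γ) : ℕ → Prog (Reg V Ar) Γ
  | 0 => P
  | w + 1 => loop (loops P w)

/-- If the variable is positive then move one unit to the auxiliary stack and run `P`. -/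
def countDown (v : V) (P : Prog (Reg V Ar) Γ) : Prog (Reg V Ar) Γ :=
  case (some (.inl v, false)) fun
    | none => skip
    | some _ => seq (pop (some (.inl v, false))) (seq (push (some (.inl v, true)) default) P)

/-- Move one unit back from the auxiliary stack of a variable. -/
def countUp (v : V) : Prog (Reg V Ar) Γ :=
  case (some (.inl v, true)) fun
    | none => skip
    | some _ => seq (pop (some (.inl v, true))) (push (some (.inl v, false)) default)

/-- Repeat `P` as often as a position expression says. -/
def walk (P : Prog (Reg V Ar) Γ) : List (Option V × ℕ) → Prog (Reg V Ar) Γ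
  | [] => skip
  | (none, w) :: e => seq (loops P w) (walk P e)
  | (some v, w) :: e =>
    seq (seq (loop (countDown v (loops P w))) (loop (countUp v))) (walk P e)

end Prog

/-! ### Correctness of the translation from array programs to stack programs. -/

section Rep

variable [Inhabited Γ] [DecidableEq V] [DecidableEq Ar] {n : ℕ} {env aux : V → ℕ}
  {s : Store Ar Γ} {pos : Ar → ℕ} {S : Reg V Ar → List Γ}

/-- Past the end of the stored part an array reads as blank, so pushing a blank when the right stack
is exhausted leaves the contents unchanged. Arrays are thereby unbounded. -/
theorem Rep.moveRight (h : Rep env aux s pos S) (a : Ar) :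
    Rep env aux s (update pos a (pos a + 1)) ((Prog.moveRight a).run n S) := by
  rcases hL : S (some (.inr a, false)) with _ | ⟨x, L⟩
  · have e : (Prog.moveRight a).run n S =
        update S (some (.inr a, true)) (default :: S (some (.inr a, true))) := by
      simp [Prog.moveRight, Prog.run, hL]
    rw [e]
    refine ⟨fun v => by simp [h.var], fun v => by simp [h.tmp], fun b => ?_, fun b i => ?_,
      by simp [h.out]⟩
    · rcases eq_or_ne b a with rfl | hb
      · simp [h.pos]
      · simp [h.pos, hb]
    · rw [← h.arr]
      rcases eq_or_ne b a with rfl | hb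
      · simp only [update_self, ne_eq, Option.some.injEq, Prod.mk.injEq, Bool.false_eq_true,
          and_false, not_false_eq_true, update_of_ne, hL, List.append_nil, List.reverse_cons,
          List.getD_eq_getElem?_getD, List.getElem?_append]
        split_ifs with hi
        · rfl
        · rw [List.getElem?_eq_none (l := (S _).reverse) (by omega)]
          rcases i - (S (some (.inr b, true))).reverse.length with _ | k <;> simp
      · simp [hb]
  · have e : (Prog.moveRight a).run n S =
        update (update S (some (.inr a, false)) L) (some (.inr a, true))
          (x :: S (some (.inr a, true))) := by
      simp [Prog.moveRight, Prog.run, hL]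
    rw [e]
    refine ⟨fun v => by simp [h.var], fun v => by simp [h.tmp], fun b => ?_, fun b i => ?_,
      by simp [h.out]⟩
    · rcases eq_or_ne b a with rfl | hb
      · simp [h.pos]
      · simp [h.pos, hb]
    · rw [← h.arr]
      rcases eq_or_ne b a with rfl | hb
      · simp [hL]
      · simp [hb]

theorem Rep.moveLeft (h : Rep env aux s pos S) (a : Ar) :
    Rep env aux s (update pos a (pos a - 1)) ((Prog.moveLeft a).run n S) := by
  rcases hL : S (some (.inr a, true)) with _ | ⟨x, L⟩
  · have e : (Prog.moveLeft a).run n S = S := by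
      simp [Prog.moveLeft, Prog.run, hL]
    have hp : pos a = 0 := by rw [← h.pos, hL, List.length_nil]
    rw [e, hp, Nat.zero_sub, ← hp, update_eq_self]
    exact h
  · have e : (Prog.moveLeft a).run n S =
        update (update S (some (.inr a, true)) L) (some (.inr a, false))
          (x :: S (some (.inr a, false))) := by
      simp [Prog.moveLeft, Prog.run, hL]
    rw [e]
    refine ⟨fun v => by simp [h.var], fun v => by simp [h.tmp], fun b => ?_, fun b i => ?_,
      by simp [h.out]⟩
    · rcases eq_or_ne b a with rfl | hb
      · simp [← h.pos, hL]
      · simp [h.pos, hb]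
    · rw [← h.arr]
      rcases eq_or_ne b a with rfl | hb
      · simp [hL]
      · simp [hb]

/-- The program `P` changes the split points of the arrays by the map `g`, and nothing else. -/
def Moves (n : ℕ) (P : Prog (Reg V Ar) Γ) (g : (Ar → ℕ) → Ar → ℕ) : Prop :=
  ∀ ⦃env aux : V → ℕ⦄ ⦃s pos S⦄, Rep env aux s pos S → Rep env aux s (g pos) (P.run n S)

theorem Moves.iterate {P : Prog (Reg V Ar) Γ} {g : (Ar → ℕ) → Ar → ℕ} (hP : Moves n P g)
    (h : Rep env aux s pos S) (m : ℕ) : Rep env aux s (g^[m] pos) ((P.run n)^[m] S) := by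
  induction m generalizing pos S with
  | zero => exact h
  | succ m ih =>
    rw [iterate_succ_apply, iterate_succ_apply]
    exact ih (hP h)

theorem Moves.loops {P : Prog (Reg V Ar) Γ} {g : (Ar → ℕ) → Ar → ℕ} (hP : Moves n P g) (w : ℕ) :
    Moves n (P.loops w) g^[n ^ w] := by
  induction w with
  | zero => simpa [Prog.loops] using hP
  | succ w ih =>
    intro env aux s pos S h
    rw [pow_succ, iterate_mul]
    exact ih.iterate h n

/-- Once the variable has reached zero the remaining rounds do nothing, which is the source of the
minimum. The movement may run while the variable is partly counted down because `Moves` quantifies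
over all values of the variables. -/
theorem Moves.countDown {P : Prog (Reg V Ar) Γ} {g : (Ar → ℕ) → Ar → ℕ} (hP : Moves n P g)
    (h : Rep env aux s pos S) (v : V) (m : ℕ) :
    Rep (update env v (env v - m)) (update aux v (aux v + min (env v) m)) s
      (g^[min (env v) m] pos) (((P.countDown v).run n)^[m] S) := by
  induction m generalizing env aux pos S with
  | zero => simpa using h
  | succ m ih =>
    rw [iterate_succ_apply]
    rcases hv : env v with _ | k
    · have e : (P.countDown v).run n S = S := by
        simp [Prog.countDown, Prog.run, h.var, hv]
      have := ih h
      rw [e]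
      simpa [hv] using this
    · have e : (P.countDown v).run n S = P.run n (update (update S (some (.inl v, false))
          (List.replicate k default)) (some (.inl v, true))
          (List.replicate (aux v + 1) default)) := by
        simp [Prog.countDown, Prog.run, h.var, h.tmp, hv, List.replicate_succ]
      have h' : Rep (update env v k) (update aux v (aux v + 1)) s pos
          (update (update S (some (.inl v, false)) (List.replicate k default))
            (some (.inl v, true)) (List.replicate (aux v + 1) default)) := by
        refine ⟨fun u => ?_, fun u => ?_, fun b => by simp [h.pos], fun b i => by simp [← h.arr],
          by simp [h.out]⟩
        · rcases eq_or_ne u v with rfl | hu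
          · simp
          · simp [hu, h.var]
        · rcases eq_or_ne u v with rfl | hu
          · simp
          · simp [hu, h.tmp]
      have := ih (hP h')
      rw [e]
      simp only [update_self, update_idem] at this
      rw [show min (k + 1) (m + 1) = min k m + 1 by omega, iterate_succ_apply,
        show k + 1 - (m + 1) = k - m by omega,
        show aux v + (min k m + 1) = aux v + 1 + min k m by omega]
      exact this

theorem Rep.countUp (h : Rep env aux s pos S) (v : V) (m : ℕ) :
    Rep (update env v (env v + min (aux v) m)) (update aux v (aux v - m)) s pos
      (((Prog.countUp v).run n)^[m] S) := by
  induction m generalizing env aux S with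
  | zero => simpa using h
  | succ m ih =>
    rw [iterate_succ_apply]
    rcases hv : aux v with _ | k
    · have e : (Prog.countUp v).run n S = S := by
        simp [Prog.countUp, Prog.run, h.tmp, hv]
      have := ih h
      rw [e]
      simpa [hv] using this
    · have e : (Prog.countUp v).run n S = update (update S (some (.inl v, true))
          (List.replicate k default)) (some (.inl v, false))
          (List.replicate (env v + 1) default) := by
        simp [Prog.countUp, Prog.run, h.var, h.tmp, hv, List.replicate_succ]
      have h' : Rep (update env v (env v + 1)) (update aux v k) s pos
          (update (update S (some (.inl v, true)) (List.replicate k default))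
            (some (.inl v, false)) (List.replicate (env v + 1) default)) := by
        refine ⟨fun u => ?_, fun u => ?_, fun b => by simp [h.pos], fun b i => by simp [← h.arr],
          by simp [h.out]⟩
        · rcases eq_or_ne u v with rfl | hu
          · simp
          · simp [hu, h.var]
        · rcases eq_or_ne u v with rfl | hu
          · simp
          · simp [hu, h.tmp]
      have := ih h'
      rw [e]
      simp only [update_self, update_idem] at this
      rw [show env v + min (k + 1) (m + 1) = env v + 1 + min k m by omega,
        show k + 1 - (m + 1) = k - m by omega]
      exact this

theorem Moves.walk {P : Prog (Reg V Ar) Γ} {g : (Ar → ℕ) → Ar → ℕ} (hP : Moves n P g)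
    (e : List (Option V × ℕ)) (h : Rep env 0 s pos S) :
    Rep env 0 s (g^[offset n env e] pos) ((P.walk e).run n S) := by
  induction e generalizing pos S with
  | nil => exact h
  | cons t e ih =>
    obtain ⟨_ | v, w⟩ := t
    · have e1 : offset n env ((none, w) :: e) = offset n env e + n ^ w := by
        simp [offset, add_comm]
      rw [e1, iterate_add_apply]
      exact ih (hP.loops w h)
    · have e1 : offset n env ((some v, w) :: e) = offset n env e + n ^ w * min (env v) n := by
        simp [offset, add_comm]
      rw [e1, iterate_add_apply, iterate_mul]
      -- Counting down parks at most `n` units, and counting up returns exactly these. The variable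
      -- is therefore restored even if it exceeds `n`.
      have h1 := ((hP.loops w).countDown h v n).countUp (n := n) v n
      simp only [update_self, update_idem, Pi.zero_apply, zero_add] at h1
      have e2 : env v - n + min (min (env v) n) n = env v := by omega
      have e3 : min (env v) n - n = (0 : V → ℕ) v := by simp
      rw [e2, e3, update_eq_self, update_eq_self] at h1
      exact ih h1

theorem iterate_moveRight (a : Ar) (k : ℕ) :
    (fun pos : Ar → ℕ => update pos a (pos a + 1))^[k] 0 = update (0 : Ar → ℕ) a k := by
  induction k with
  | zero => simp
  | succ k ih => simp [iterate_succ_apply', ih]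

theorem iterate_moveLeft (a : Ar) (k m : ℕ) :
    (fun pos : Ar → ℕ => update pos a (pos a - 1))^[k] (update (0 : Ar → ℕ) a m) =
      update (0 : Ar → ℕ) a (m - k) := by
  induction k with
  | zero => simp
  | succ k ih => simp [iterate_succ_apply', ih, Nat.sub_sub]

theorem Rep.seek (h : Rep env 0 s 0 S) (a : Ar) (e : List (Option V × ℕ)) :
    Rep env 0 s (update (0 : Ar → ℕ) a (offset n env e)) (((Prog.moveRight a).walk e).run n S) := by
  rw [← iterate_moveRight]
  exact Moves.walk (fun _ _ _ _ _ h => h.moveRight a) e h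

theorem Rep.rewind {a : Ar} {e : List (Option V × ℕ)}
    (h : Rep env 0 s (update (0 : Ar → ℕ) a (offset n env e)) S) :
    Rep env 0 s 0 (((Prog.moveLeft a).walk e).run n S) := by
  have := Moves.walk (g := fun pos => update pos a (pos a - 1))
    (fun _ _ _ _ _ h => h.moveLeft (n := n) a) e h
  rw [iterate_moveLeft, Nat.sub_self] at this
  simpa using this

theorem Rep.read {a : Ar} {k : ℕ} (h : Rep env aux s pos S) (hk : pos a = k) :
    (S (some (.inr a, false))).head?.getD default = s.arr a k := by
  rw [← h.arr, List.getD_eq_getElem?_getD, List.getElem?_append_right (by simp [h.pos, hk]),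
    List.head?_eq_getElem?]
  simp [h.pos, hk]

/-- The top of the right stack is the entry at the split point. If that stack is empty, its tail is
empty too, and the write simply extends the stored part. -/
theorem Rep.write {a : Ar} {k : ℕ} (h : Rep env aux s pos S) (hk : pos a = k) (x : Γ) :
    Rep env aux (s.put a k x) pos
      (update S (some (.inr a, false)) (x :: (S (some (.inr a, false))).tail)) := by
  refine ⟨fun v => by simp [h.var], fun v => by simp [h.tmp], fun b => by simp [h.pos],
    fun b i => ?_, by simp [h.out]⟩
  rcases eq_or_ne b a with rfl | hb
  · have hlen := h.pos b
    rw [hk] at hlen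
    have harr := h.arr b i
    simp only [ne_eq, Option.some.injEq, Prod.mk.injEq, Bool.true_eq_false, and_false,
      not_false_eq_true, update_of_ne, update_self, Store.put_arr, List.getD_eq_getElem?_getD,
      List.getElem?_append, List.length_reverse, hlen] at harr ⊢
    rcases lt_trichotomy i k with hi | rfl | hi
    · simp only [hi, if_true] at harr ⊢
      rw [harr, update_of_ne hi.ne]
    · simp
    · have h1 : ¬ i < k := by omega
      obtain ⟨j, rfl⟩ : ∃ j, i = k + (j + 1) := ⟨i - k - 1, by omega⟩
      simp only [h1, if_false, Nat.add_sub_cancel_left, List.getElem?_cons_succ] at harr ⊢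
      rw [update_of_ne hi.ne', ← harr, List.getElem?_tail]
  · simp [← h.arr, hb]

/-- The translation of programs on arrays to programs on stacks. -/
def Cmd.compile : Cmd V Ar Γ → Prog (Reg V Ar) Γ
  | skip => .skip
  | seq P Q => .seq P.compile Q.compile
  | set a e x => .seq ((Prog.moveRight a).walk e) <| .seq (.pop (some (.inr a, false))) <|
      .seq (.push (some (.inr a, false)) x) ((Prog.moveLeft a).walk e)
  | case a e f => .seq ((Prog.moveRight a).walk e) <| .case (some (.inr a, false)) fun o =>
      .seq ((Prog.moveLeft a).walk e) (f (o.getD default)).compile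
  | loop v P => .seq (.loop (.seq P.compile (.push (some (.inl v, false)) default)))
      (.loop (.pop (some (.inl v, false))))
  | emit x => .push none x

theorem Rep.addVar (h : Rep env aux s pos S) (v : V) :
    Rep (update env v (env v + 1)) aux s pos
      (update S (some (.inl v, false)) (default :: S (some (.inl v, false)))) := by
  refine ⟨fun u => ?_, fun u => by simp [h.tmp], fun b => by simp [h.pos],
    fun b i => by simp [← h.arr], by simp [h.out]⟩
  rcases eq_or_ne u v with rfl | hu
  · simp [h.var, List.replicate_succ]
  · simp [hu, h.var]

theorem Rep.popVar (h : Rep env aux s pos S) (v : V) (m : ℕ) :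
    Rep (update env v (env v - m)) aux s pos
      (((Prog.pop (some (.inl v, false))).run n)^[m] S) := by
  induction m generalizing env S with
  | zero => simpa using h
  | succ m ih =>
    rw [iterate_succ_apply]
    have h' : Rep (update env v (env v - 1)) aux s pos
        ((Prog.pop (some (.inl v, false))).run n S) := by
      refine ⟨fun u => ?_, fun u => by simp [Prog.run, h.tmp], fun b => by simp [Prog.run, h.pos],
        fun b i => by simp [Prog.run, ← h.arr], by simp [Prog.run, h.out]⟩
      rcases eq_or_ne u v with rfl | hu
      · simp [Prog.run, h.var]
      · simp [Prog.run, hu, h.var]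
    have := ih h'
    simpa [Nat.sub_sub, add_comm 1] using this

/-- Between commands every array is rewound to position zero and every auxiliary stack is empty, so
each access can start its walk from the left end. -/
theorem Rep.compile (C : Cmd V Ar Γ) : ∀ {env : V → ℕ} {s : Store Ar Γ} {S : Reg V Ar → List Γ},
    Rep env 0 s 0 S → Rep env 0 (C.exec n env s) 0 (C.compile.run n S) := by
  induction C with
  | skip => intro env s S h; exact h
  | seq P Q ihP ihQ => intro env s S h; exact ihQ (ihP h)
  | set a e x =>
    intro env s S h
    have h1 := ((h.seek (n := n) a e).write (update_self _ _ _) x).rewind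
    simpa [Cmd.compile, Prog.run, Cmd.exec] using h1
  | case a e f ih =>
    intro env s S h
    have h1 := h.seek (n := n) a e
    have h2 := h1.read (update_self _ _ _)
    simp only [Cmd.compile, Prog.run, Cmd.exec]
    rw [h2]
    exact ih _ h1.rewind
  | loop v P ih =>
    intro env s S h
    have key : ∀ m, Rep (update env v (env v + m)) 0
        ((List.range m).foldl (fun s i => P.exec n (update env v (env v + i)) s) s) 0
        (((Prog.seq P.compile (.push (some (.inl v, false)) default)).run n)^[m] S) := by
      intro m
      induction m with
      | zero => simpa using h
      | succ m ihm =>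
        rw [List.range_succ, List.foldl_append, iterate_succ_apply']
        have := (ih ihm).addVar v
        simpa [Prog.run, add_assoc] using this
    -- The `n` rounds have raised the loop variable by `n`; the second loop removes these units
    -- again.
    have h2 := (key n).popVar (n := n) v n
    simpa [Cmd.compile, Prog.run, Cmd.exec] using h2
  | emit x =>
    intro env s S h
    exact ⟨fun v => by simp [Cmd.compile, Prog.run, h.var],
      fun v => by simpa [Cmd.compile, Prog.run] using h.tmp v,
      fun a => by simp [Cmd.compile, Prog.run, h.pos],
      fun a i => by simp [Cmd.compile, Prog.run, Cmd.exec, ← h.arr],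
      by simp [Cmd.compile, Prog.run, Cmd.exec, h.out]⟩

/-- The store at the beginning: the array `a` holds the input, the other arrays are blank. -/
def Store.init (a : Ar) (x : List Γ) : Store Ar Γ where
  arr := update (fun _ _ => default) a fun i => x.getD i default
  out := []

/-- A function that is computed by a program on arrays is computable in polynomial time. -/
theorem Cmd.computableInPolyTime [Fintype Γ] [Fintype V] [Fintype Ar] {I O α : Type} [Fintype I]
    (ea : α → List I) (f : α → List O) (inSym : I → Γ) (osym : O → Γ) (hosym : Injective osym)
    (C : Cmd V Ar Γ) (a₀ : Ar)
    (h : ∀ a, (C.exec ((ea a).length + 1) (fun _ => 0) (.init a₀ ((ea a).map inSym))).out =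
      (f a).reverse.map osym) :
    Nonempty (TM2ComputableInPolyTime ea (fun w : List O => w) f) := by
  refine Prog.computableInPolyTime inSym (Prog.seq (.loop (.moveLeft a₀)) C.compile)
    (some (.inr a₀, true)) none ea f osym hosym (by simp) fun a => ?_
  rw [← h a]
  refine (Rep.compile C ?_).out
  have h0 : Rep (fun _ => 0) 0 (.init a₀ ((ea a).map inSym)) (update (0 : Ar → ℕ) a₀ (ea a).length)
      (update (fun _ => []) (some (.inr a₀, true)) ((ea a).reverse.map inSym) :
        Reg V Ar → List Γ) := by
    refine ⟨fun v => by simp, fun v => by simp, fun b => ?_, fun b i => ?_,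
      by simp [Store.init]⟩
    · rcases eq_or_ne b a₀ with rfl | hb
      · simp
      · simp [hb]
    · rcases eq_or_ne b a₀ with rfl | hb
      · simp [Store.init]
      · simp [hb, Store.init]
  -- Loading left the reversed input on the left stack, so the array is split at its right end. One
  -- more move than the input length is harmless, since moving left at position zero does nothing.
  have h1 := Moves.iterate (g := fun pos => update pos a₀ (pos a₀ - 1))
    (fun _ _ _ _ _ h => h.moveLeft (n := (ea a).length + 1) a₀) h0 ((ea a).length + 1)
  rw [iterate_moveLeft, show (ea a).length - ((ea a).length + 1) = 0 by omega,
    show update (0 : Ar → ℕ) a₀ 0 = 0 from update_eq_self a₀ 0] at h1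
  exact h1

end Rep

end ClosestElement

namespace ClosestElement

open Function

/-! ### Reasoning about loops -/

section Loops

variable {α : Type*} {n : ℕ}

theorem foldl_range_induction (f : α → ℕ → α) (Inv : ℕ → α → Prop) {s : α} (h0 : Inv 0 s)
    (hs : ∀ i < n, ∀ t, Inv i t → Inv (i + 1) (f t i)) : Inv n ((List.range n).foldl f s) := by
  have key : ∀ m ≤ n, Inv m ((List.range m).foldl f s) := by
    intro m
    induction m with
    | zero => intro _; exact h0
    | succ m ih =>
      intro hm
      rw [List.range_succ, List.foldl_append]
      exact hs m hm _ (ih (by omega))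
  exact key n le_rfl

variable {V Ar Γ : Type} [DecidableEq V] [DecidableEq Ar] {env : V → ℕ} {v : V}
  {P : Cmd V Ar Γ} {s : Store Ar Γ}

theorem Cmd.exec_loop (hv : env v = 0) (s : Store Ar Γ) : (Cmd.loop v P).exec n env s =
    (List.range n).foldl (fun s i => P.exec n (update env v i) s) s := by
  simp [Cmd.exec, hv]

theorem Cmd.exec_loop_induction (hv : env v = 0) (Inv : ℕ → Store Ar Γ → Prop) (h0 : Inv 0 s)
    (hs : ∀ i < n, ∀ t, Inv i t → Inv (i + 1) (P.exec n (update env v i) t)) :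
    Inv n ((Cmd.loop v P).exec n env s) := by
  rw [Cmd.exec_loop hv]
  exact foldl_range_induction _ Inv h0 hs

/-- A loop all of whose steps are increasing for a preorder, where step number `i` makes sure that
`Q i` holds and `Q i` cannot be destroyed later, makes sure that `Q i` holds for all `i`. -/
theorem Cmd.exec_loop_achieve (hv : env v = 0) (R : Store Ar Γ → Store Ar Γ → Prop)
    (hrefl : ∀ t, R t t) (htrans : ∀ t u w, R t u → R u w → R t w)
    (Q : ℕ → Store Ar Γ → Prop) (hQ : ∀ i t u, R t u → Q i t → Q i u)
    (h : ∀ i < n, ∀ t, R s t →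
      R t (P.exec n (update env v i) t) ∧ Q i (P.exec n (update env v i) t)) :
    R s ((Cmd.loop v P).exec n env s) ∧ ∀ i < n, Q i ((Cmd.loop v P).exec n env s) := by
  refine Cmd.exec_loop_induction hv (fun m t => R s t ∧ ∀ i < m, Q i t) ⟨hrefl s, by simp⟩ ?_
  rintro i hi t ⟨h1, h2⟩
  obtain ⟨h3, h4⟩ := h i hi t h1
  refine ⟨htrans _ _ _ h1 h3, fun j hj => ?_⟩
  rcases Nat.lt_succ_iff_lt_or_eq.1 hj with hj | rfl
  · exact hQ _ _ _ h3 (h2 j hj)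
  · exact h4

end Loops

/-! ### Positions in tables -/

section Positions

variable {V : Type} {n : ℕ} {env : V → ℕ}

/-- Quotient and remainder by `n` recover row and column. Only the columns need a bound, so tables
may have more than `n` rows. -/
theorem table_inj {p q p' q' : ℕ} (hq : q < n) (hq' : q' < n) :
    p * n + q = p' * n + q' ↔ p = p' ∧ q = q' := by
  constructor
  · intro h
    have hn : 0 < n := by omega
    have h1 : (p * n + q) / n = (p' * n + q') / n := by rw [h]
    have h2 : (p * n + q) % n = (p' * n + q') % n := by rw [h]
    rw [mul_comm p, mul_comm p', Nat.mul_add_div hn, Nat.mul_add_div hn, Nat.div_eq_of_lt hq,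
      Nat.div_eq_of_lt hq'] at h1
    rw [mul_comm p, mul_comm p', Nat.mul_add_mod, Nat.mul_add_mod, Nat.mod_eq_of_lt hq,
      Nat.mod_eq_of_lt hq'] at h2
    exact ⟨by omega, h2⟩
  · rintro ⟨rfl, rfl⟩
    rfl

/-- The position with one index. -/
def pos₁ (u : V) : List (Option V × ℕ) := [(some u, 0)]

/-- The position with two indices. -/
def pos₂ (u v : V) : List (Option V × ℕ) := [(some u, 1), (some v, 0)]

/-- The position with three indices. -/
def pos₃ (u v w : V) : List (Option V × ℕ) := [(some u, 2), (some v, 1), (some w, 0)]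

theorem offset_pos₁ {u : V} (hu : env u < n) : offset n env (pos₁ u) = env u := by
  simp [offset, pos₁, hu.le]

theorem offset_pos₂ {u v : V} (hu : env u < n) (hv : env v < n) :
    offset n env (pos₂ u v) = env u * n + env v := by
  simp [offset, pos₂, hu.le, hv.le, mul_comm]

theorem offset_pos₃ {u v w : V} (hu : env u < n) (hv : env v < n) (hw : env w < n) :
    offset n env (pos₃ u v w) = (env u * n + env v) * n + env w := by
  simp only [offset, pos₃, List.map_cons, Option.elim_some, hu.le, inf_of_le_left, hv.le, pow_one,
    pow_zero, hw.le, one_mul, List.map_nil, List.sum_cons, List.sum_nil, add_zero]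
  ring

end Positions

/-! ### The algorithm -/

/-- The arrays of the algorithm. -/
inductive Arr : Type
  | inp | seen | start | edge | fold | layer | word | done
  deriving DecidableEq

instance : Fintype Arr :=
  ⟨{.inp, .seen, .start, .edge, .fold, .layer, .word, .done}, fun a => by cases a <;> simp⟩

variable {L : Type}

/-- The alphabet of the arrays: blank, a mark that also serves as the separator, and letters. -/
abbrev Sym (L : Type) : Type := Option (Option L)

/-- The mark. -/
abbrev mark : Sym L := some none

/-- A letter as an array symbol. -/
abbrev letter (y : L) : Sym L := some (some y)

/-- Programs for the algorithm. -/
abbrev ACmd (L : Type) : Type := Cmd (Fin 7) Arr (Sym L)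

namespace ACmd

/-- Run a program if there is a mark. -/
def ifMark (a : Arr) (e : List (Option (Fin 7) × ℕ)) (P : ACmd L) : ACmd L :=
  .case a e fun
    | some none => P
    | _ => .skip

/-- Run a program that depends on a letter, if there is one. -/
def ifLetter (a : Arr) (e : List (Option (Fin 7) × ℕ)) (P : L → ACmd L) : ACmd L :=
  .case a e fun
    | some (some y) => P y
    | _ => .skip

variable {n : ℕ} {env : Fin 7 → ℕ} {s : Store Arr (Sym L)} {a : Arr}
  {e : List (Option (Fin 7) × ℕ)}

theorem exec_ifMark_pos {P : ACmd L} (h : s.arr a (offset n env e) = mark) :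
    (ifMark a e P).exec n env s = P.exec n env s := by
  simp [ifMark, Cmd.exec, h]

theorem exec_ifMark_neg {P : ACmd L} (h : s.arr a (offset n env e) ≠ mark) :
    (ifMark a e P).exec n env s = s := by
  simp only [ifMark, Cmd.exec]

theorem exec_ifLetter_pos {P : L → ACmd L} {y : L} (h : s.arr a (offset n env e) = letter y) :
    (ifLetter a e P).exec n env s = (P y).exec n env s := by
  simp [ifLetter, Cmd.exec, h]

theorem exec_ifLetter_neg {P : L → ACmd L} (h : ∀ y, s.arr a (offset n env e) ≠ letter y) :
    (ifLetter a e P).exec n env s = s := by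
  simp only [ifLetter, Cmd.exec]

end ACmd

open ACmd

section Algorithm

/-- One round of folding: make the fold relation transitive, and close it under edges with the
same label. -/
def foldRound [DecidableEq L] : ACmd L :=
  .seq
    (.loop 0 <| .loop 1 <| .loop 2 <| ifMark .fold (pos₂ 0 1) <| ifMark .fold (pos₂ 1 2) <|
      .set .fold (pos₂ 0 2) mark)
    (.loop 0 <| .loop 1 <| .loop 2 <| .loop 3 <| ifLetter .edge (pos₂ 0 1) fun y =>
      .case .edge (pos₂ 2 3) fun z =>
        if z = letter y then ifMark .fold (pos₂ 0 2) (.set .fold (pos₂ 1 3) mark) else .skip)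

/-- Fold until the fold relation is closed. -/
def foldAll [DecidableEq L] : ACmd L := .loop 4 <| .loop 5 <| .loop 6 foldRound

/-- The entry of the table `a` in row `p` and column `q`. -/
def Store.tab (n : ℕ) (s : Store Arr (Sym L)) (a : Arr) (p q : ℕ) : Sym L := s.arr a (p * n + q)

/-- A relation on the vertices that is closed under folding of a graph with labels `ed`. -/
structure FoldClosed (n : ℕ) (ed : ℕ → ℕ → Sym L) (T : ℕ → ℕ → Prop) : Prop where
  trans : ∀ p < n, ∀ q < n, ∀ r < n, T p q → T q r → T p r
  fold : ∀ p < n, ∀ p' < n, ∀ q < n, ∀ q' < n, ∀ y, ed p p' = letter y → ed q q' = letter y →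
    T p q → T p' q'

/-- `t` arises from `s` by extending the fold relation in a sound way. -/
structure FoldExt (n : ℕ) (s t : Store Arr (Sym L)) : Prop where
  arr : ∀ a ≠ .fold, t.arr a = s.arr a
  out : t.out = s.out
  mono : ∀ p < n, ∀ q < n, s.tab n .fold p q = mark → t.tab n .fold p q = mark
  sound : ∀ T, FoldClosed n (s.tab n .edge) T →
    (∀ p < n, ∀ q < n, s.tab n .fold p q = mark → T p q) →
    ∀ p < n, ∀ q < n, t.tab n .fold p q = mark → T p q

theorem FoldExt.refl {n : ℕ} (s : Store Arr (Sym L)) : FoldExt n s s :=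
  ⟨fun _ _ => rfl, rfl, fun _ _ _ _ h => h, fun _ _ h => h⟩

theorem FoldExt.tab {n : ℕ} {s t : Store Arr (Sym L)} (h : FoldExt n s t) {a : Arr}
    (ha : a ≠ .fold) : t.tab n a = s.tab n a := by
  funext p q
  simp [Store.tab, h.arr a ha]

theorem FoldExt.trans {n : ℕ} (s t u : Store Arr (Sym L)) (h₁ : FoldExt n s t)
    (h₂ : FoldExt n t u) : FoldExt n s u := by
  refine ⟨fun a ha => (h₂.arr a ha).trans (h₁.arr a ha), h₂.out.trans h₁.out,
    fun p hp q hq h => h₂.mono p hp q hq (h₁.mono p hp q hq h), fun T hT h => ?_⟩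
  refine h₂.sound T ?_ (h₁.sound T hT h)
  rwa [h₁.tab (by simp)]

/-- Soundness is tested against every closed relation above the current table, so marking a pair is
allowed as soon as all of these relations contain it. -/
theorem FoldExt.set {n : ℕ} {env : Fin 7 → ℕ} {u v : Fin 7} (s : Store Arr (Sym L))
    (hu : env u < n) (hv : env v < n)
    (h : ∀ T, FoldClosed n (s.tab n .edge) T →
      (∀ p < n, ∀ q < n, s.tab n .fold p q = mark → T p q) → T (env u) (env v)) :
    FoldExt n s ((Cmd.set .fold (pos₂ u v) mark).exec n env s) ∧
      ((Cmd.set .fold (pos₂ u v) mark).exec n env s).tab n .fold (env u) (env v) = mark := by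
  have key : ∀ p q, q < n → ((Cmd.set .fold (pos₂ u v) mark).exec n env s).tab n .fold p q =
      if p = env u ∧ q = env v then mark else s.tab n .fold p q := by
    intro p q hq
    simp only [Cmd.exec, Store.tab, Store.put_arr, update_self, offset_pos₂ hu hv, update_apply,
      table_inj hq hv]
  refine ⟨⟨fun a ha => by simp [Cmd.exec, ha], rfl, fun p _ q hq hpq => ?_,
    fun T hT hs p hp q hq hpq => ?_⟩, ?_⟩
  · rw [key p q hq]
    split_ifs
    · rfl
    · exact hpq
  · rw [key p q hq] at hpq
    split_ifs at hpq with hc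
    · rw [hc.1, hc.2]
      exact h T hT hs
    · exact hs p hp q hq hpq
  · rw [key _ _ hv, if_pos ⟨rfl, rfl⟩]

/-- The premises refer to the table before the round. Marks are never erased, so these premises
still hold when the loops reach the relevant indices, even though the table changes on the way. -/
theorem foldRound_spec [DecidableEq L] {n : ℕ} {env : Fin 7 → ℕ} (h0 : env 0 = 0) (h1 : env 1 = 0)
    (h2 : env 2 = 0) (h3 : env 3 = 0) (s : Store Arr (Sym L)) :
    FoldExt n s (foldRound.exec n env s) ∧
    (∀ p < n, ∀ q < n, ∀ r < n, s.tab n .fold p q = mark → s.tab n .fold q r = mark →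
      (foldRound.exec n env s).tab n .fold p r = mark) ∧
    ∀ p < n, ∀ p' < n, ∀ q < n, ∀ q' < n, ∀ y, s.tab n .edge p p' = letter y →
      s.tab n .edge q q' = letter y → s.tab n .fold p q = mark →
      (foldRound.exec n env s).tab n .fold p' q' = mark := by
  set P₁ : ACmd L := .loop 0 <| .loop 1 <| .loop 2 <| ifMark .fold (pos₂ 0 1) <|
    ifMark .fold (pos₂ 1 2) <| .set .fold (pos₂ 0 2) mark with hP₁
  set P₂ : ACmd L := .loop 0 <| .loop 1 <| .loop 2 <| .loop 3 <|
    ifLetter .edge (pos₂ 0 1) fun y => .case .edge (pos₂ 2 3) fun z =>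
      if z = letter y then ifMark .fold (pos₂ 0 2) (.set .fold (pos₂ 1 3) mark) else .skip
    with hP₂
  have hs : foldRound.exec n env s = P₂.exec n env (P₁.exec n env s) := rfl
  have A : FoldExt n s (P₁.exec n env s) ∧ ∀ p < n, ∀ q < n, ∀ r < n,
      s.tab n .fold p q = mark → s.tab n .fold q r = mark →
      (P₁.exec n env s).tab n .fold p r = mark := by
    refine Cmd.exec_loop_achieve h0 (FoldExt n) FoldExt.refl FoldExt.trans
      (fun p t => ∀ q < n, ∀ r < n, s.tab n .fold p q = mark → s.tab n .fold q r = mark →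
        (p < n → t.tab n .fold p r = mark)) ?_ ?_ |>.imp_right fun h p hp q hq r hr a b =>
          h p hp q hq r hr a b hp
    · exact fun p t u htu h q hq r hr a b hp => htu.mono _ hp _ hr (h q hq r hr a b hp)
    intro p hp t ht
    refine Cmd.exec_loop_achieve (by simp [h1]) (FoldExt n) FoldExt.refl FoldExt.trans
      (fun q t => ∀ r < n, s.tab n .fold p q = mark → s.tab n .fold q r = mark →
        (p < n → t.tab n .fold p r = mark)) ?_ ?_
    · exact fun q t u htu h r hr a b hp => htu.mono _ hp _ hr (h r hr a b hp)
    intro q hq t' ht'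
    refine Cmd.exec_loop_achieve (by simp [h2]) (FoldExt n) FoldExt.refl FoldExt.trans
      (fun r t => s.tab n .fold p q = mark → s.tab n .fold q r = mark →
        (p < n → r < n → t.tab n .fold p r = mark)) ?_ ?_ |>.imp_right fun h r hr a b hp =>
          h r hr a b hp hr
    · exact fun r t u htu h a b hp hr => htu.mono _ hp _ hr (h a b hp hr)
    intro r hr t'' ht''
    have hst := FoldExt.trans _ _ _ (FoldExt.trans _ _ _ ht ht') ht''
    set env' := update (update (update env 0 p) 1 q) 2 r with henv'
    have e0 : env' 0 = p := by simp [henv']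
    have e1 : env' 1 = q := by simp [henv']
    have e2 : env' 2 = r := by simp [henv']
    have o1 : offset n env' (pos₂ 0 1) = p * n + q := by rw [offset_pos₂] <;> simp [*]
    have o2 : offset n env' (pos₂ 1 2) = q * n + r := by rw [offset_pos₂] <;> simp [*]
    by_cases c1 : t''.tab n .fold p q = mark
    · rw [exec_ifMark_pos (by rw [o1]; exact c1)]
      by_cases c2 : t''.tab n .fold q r = mark
      · rw [exec_ifMark_pos (by rw [o2]; exact c2)]
        have := FoldExt.set (n := n) (env := env') (u := 0) (v := 2) t'' (by rw [e0]; exact hp)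
          (by rw [e2]; exact hr) (fun T hT hs => by
            rw [e0, e2]
            exact hT.trans p hp q hq r hr (hs p hp q hq c1) (hs q hq r hr c2))
        rw [e0, e2] at this
        exact ⟨this.1, fun _ _ _ _ => this.2⟩
      · rw [exec_ifMark_neg (by rw [o2]; exact c2)]
        exact ⟨FoldExt.refl _, fun a b _ _ => absurd (hst.mono q hq r hr b) c2⟩
    · rw [exec_ifMark_neg (by rw [o1]; exact c1)]
      exact ⟨FoldExt.refl _, fun a b _ _ => absurd (hst.mono p hp q hq a) c1⟩
  set s₁ := P₁.exec n env s
  -- The bounds on `p'` and `q'` are repeated so that the property fixed in each inner loop carries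
  -- the bounds needed for its preservation by `FoldExt.mono`.
  have B : FoldExt n s₁ (P₂.exec n env s₁) ∧ ∀ p < n, ∀ p' < n, ∀ q < n, ∀ q' < n,
      p' < n → q' < n → ∀ y,
      s₁.tab n .edge p p' = letter y → s₁.tab n .edge q q' = letter y →
      s₁.tab n .fold p q = mark → (P₂.exec n env s₁).tab n .fold p' q' = mark := by
    refine Cmd.exec_loop_achieve h0 (FoldExt n) FoldExt.refl FoldExt.trans
      (fun p t => ∀ p' < n, ∀ q < n, ∀ q' < n, p' < n → q' < n → ∀ y,
      s₁.tab n .edge p p' = letter y → s₁.tab n .edge q q' = letter y →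
      s₁.tab n .fold p q = mark → t.tab n .fold p' q' = mark) ?_ ?_
    · exact fun p t u htu h p' hp' q hq q' hq' h1 h2 y a b c =>
        htu.mono _ h1 _ h2 (h p' hp' q hq q' hq' h1 h2 y a b c)
    intro p hp t ht
    refine Cmd.exec_loop_achieve (by simp [h1]) (FoldExt n) FoldExt.refl FoldExt.trans
      (fun p' t => ∀ q < n, ∀ q' < n, p' < n → q' < n → ∀ y,
      s₁.tab n .edge p p' = letter y → s₁.tab n .edge q q' = letter y →
      s₁.tab n .fold p q = mark → t.tab n .fold p' q' = mark) ?_ ?_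
    · exact fun p' t u htu h q hq q' hq' h1 h2 y a b c =>
        htu.mono _ h1 _ h2 (h q hq q' hq' h1 h2 y a b c)
    intro p' hp' t ht'
    refine Cmd.exec_loop_achieve (by simp [h2]) (FoldExt n) FoldExt.refl FoldExt.trans
      (fun q t => ∀ q' < n, p' < n → q' < n → ∀ y,
      s₁.tab n .edge p p' = letter y → s₁.tab n .edge q q' = letter y →
      s₁.tab n .fold p q = mark → t.tab n .fold p' q' = mark) ?_ ?_
    · exact fun q t u htu h q' hq' h1 h2 y a b c =>
        htu.mono _ h1 _ h2 (h q' hq' h1 h2 y a b c)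
    intro q hq t ht''
    refine Cmd.exec_loop_achieve (by simp [h3]) (FoldExt n) FoldExt.refl FoldExt.trans
      (fun q' t => p' < n → q' < n → ∀ y,
      s₁.tab n .edge p p' = letter y → s₁.tab n .edge q q' = letter y →
      s₁.tab n .fold p q = mark → t.tab n .fold p' q' = mark) ?_ ?_
    · exact fun q' t u htu h h1 h2 y a b c => htu.mono _ h1 _ h2 (h h1 h2 y a b c)
    intro q' hq' t ht'''
    have hst := FoldExt.trans _ _ _ (FoldExt.trans _ _ _ (FoldExt.trans _ _ _ ht ht') ht'') ht'''
    set env' := update (update (update (update env 0 p) 1 p') 2 q) 3 q' with henv'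
    have e0 : env' 0 = p := by simp [henv']
    have e1 : env' 1 = p' := by simp [henv']
    have e2 : env' 2 = q := by simp [henv']
    have e3 : env' 3 = q' := by simp [henv']
    have o1 : offset n env' (pos₂ 0 1) = p * n + p' := by rw [offset_pos₂] <;> simp [*]
    have o2 : offset n env' (pos₂ 2 3) = q * n + q' := by rw [offset_pos₂] <;> simp [*]
    have o3 : offset n env' (pos₂ 0 2) = p * n + q := by rw [offset_pos₂] <;> simp [*]
    rw [← hst.tab (by simp)]
    by_cases c1 : ∃ y, t.tab n .edge p p' = letter y
    · obtain ⟨y, c1⟩ := c1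
      rw [exec_ifLetter_pos (by rw [o1]; exact c1)]
      have e : ∀ f : Sym L → ACmd L, (Cmd.case .edge (pos₂ 2 3) f).exec n env' t =
          (f (t.tab n .edge q q')).exec n env' t := by
        intro f
        simp only [Cmd.exec, o2, Store.tab]
      rw [e]
      split_ifs with c2
      · by_cases c3 : t.tab n .fold p q = mark
        · rw [exec_ifMark_pos (by rw [o3]; exact c3)]
          have := FoldExt.set (n := n) (env := env') (u := 1) (v := 3) t (by rw [e1]; exact hp')
            (by rw [e3]; exact hq') (fun T hT hs => by
              rw [e1, e3]
              exact hT.fold p hp p' hp' q hq q' hq' y c1 c2 (hs p hp q hq c3))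
          rw [e1, e3] at this
          exact ⟨this.1, fun _ _ _ _ _ _ => this.2⟩
        · rw [exec_ifMark_neg (by rw [o3]; exact c3)]
          exact ⟨FoldExt.refl _, fun _ _ _ _ _ c => absurd (hst.mono p hp q hq c) c3⟩
      · refine ⟨FoldExt.refl _, fun _ _ z a b _ => absurd ?_ c2⟩
        rw [b, ← a, c1]
    · rw [exec_ifLetter_neg (by rw [o1]; exact fun y hy => c1 ⟨y, hy⟩)]
      exact ⟨FoldExt.refl _, fun _ _ y a _ _ => absurd ⟨y, a⟩ c1⟩
  rw [hs]
  refine ⟨FoldExt.trans _ _ _ A.1 B.1, fun p hp q hq r hr a b =>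
    B.1.mono p hp r hr (A.2 p hp q hq r hr a b), fun p hp p' hp' q hq q' hq' y a b c => ?_⟩
  rw [← A.1.tab (by simp)] at a b
  exact B.2 p hp p' hp' q hq q' hq' hp' hq' y a b (A.1.mono p hp q hq c)

end Algorithm

end ClosestElement

namespace ClosestElement

open Function ACmd

variable {L : Type}

/-! ### Termination of folding. -/

section FoldAll

open Classical in
/-- The set of marked pairs in the table of the fold relation. -/
noncomputable def Store.marked (n : ℕ) (s : Store Arr (Sym L)) : Finset (ℕ × ℕ) :=
  (Finset.range n ×ˢ Finset.range n).filter fun x => s.tab n .fold x.1 x.2 = mark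

theorem Store.mem_marked {n : ℕ} {s : Store Arr (Sym L)} {p q : ℕ} :
    (p, q) ∈ s.marked n ↔ (p < n ∧ q < n) ∧ s.tab n .fold p q = mark := by
  simp [Store.marked]

/-- The fold relation of a store is closed under folding. -/
def Store.Closed (n : ℕ) (s : Store Arr (Sym L)) : Prop :=
  FoldClosed n (s.tab n .edge) fun p q => s.tab n .fold p q = mark

/-- A round that marks nothing new certifies that the table is closed. A round that marks something
new raises the count, and this cannot happen to a closed table, by soundness against the table
itself. -/
theorem foldRound_progress [DecidableEq L] {n m : ℕ} {env : Fin 7 → ℕ} (h0 : env 0 = 0)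
    (h1 : env 1 = 0) (h2 : env 2 = 0) (h3 : env 3 = 0) {s t : Store Arr (Sym L)}
    (h : FoldExt n s t ∧ (t.Closed n ∨ m ≤ (t.marked n).card)) :
    FoldExt n s (foldRound.exec n env t) ∧ ((foldRound.exec n env t).Closed n ∨
      m + 1 ≤ ((foldRound.exec n env t).marked n).card) := by
  obtain ⟨hst, ht⟩ := h
  obtain ⟨hE, hT, hF⟩ := foldRound_spec h0 h1 h2 h3 t (n := n)
  set t' := foldRound.exec n env t
  refine ⟨FoldExt.trans _ _ _ hst hE, ?_⟩
  have hsub : t.marked n ⊆ t'.marked n := by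
    rintro ⟨p, q⟩ hpq
    rw [Store.mem_marked] at hpq ⊢
    exact ⟨hpq.1, hE.mono p hpq.1.1 q hpq.1.2 hpq.2⟩
  by_cases hsub' : t'.marked n ⊆ t.marked n
  · left
    have back : ∀ p < n, ∀ q < n, t'.tab n .fold p q = mark → t.tab n .fold p q = mark :=
      fun p hp q hq hpq => (Store.mem_marked.1 (hsub' (Store.mem_marked.2 ⟨⟨hp, hq⟩, hpq⟩))).2
    refine ⟨fun p hp q hq r hr a b => hT p hp q hq r hr (back p hp q hq a) (back q hq r hr b),
      fun p hp p' hp' q hq q' hq' y a b c => ?_⟩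
    rw [hE.tab (by simp)] at a b
    exact hF p hp p' hp' q hq q' hq' y a b (back p hp q hq c)
  · rcases ht with ht | ht
    · refine absurd ?_ hsub'
      rintro ⟨p, q⟩ hpq
      rw [Store.mem_marked] at hpq ⊢
      exact ⟨hpq.1, hE.sound _ ht (fun _ _ _ _ h => h) p hpq.1.1 q hpq.1.2 hpq.2⟩
    · right
      have := Finset.card_lt_card (Finset.ssubset_iff_subset_ne.2
        ⟨hsub, fun e => hsub' e.symm.subset⟩)
      omega

theorem foldAll_spec [DecidableEq L] {n : ℕ} (hn : 2 ≤ n) (s : Store Arr (Sym L)) :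
    FoldExt n s (foldAll.exec n (fun _ => 0) s) ∧
      (foldAll.exec n (fun _ => 0) s).Closed n := by
  have key : FoldExt n s (foldAll.exec n (fun _ => 0) s) ∧
      ((foldAll.exec n (fun _ => 0) s).Closed n ∨
        n * n * n ≤ ((foldAll.exec n (fun _ => 0) s).marked n).card) := by
    rw [mul_assoc]
    refine Cmd.exec_loop_induction (by rfl) (fun i t => FoldExt n s t ∧ (t.Closed n ∨
      i * (n * n) ≤ (t.marked n).card)) ⟨FoldExt.refl _, Or.inr (by simp)⟩ fun i _ t ht => ?_
    rw [Nat.succ_mul]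
    refine Cmd.exec_loop_induction (by simp) (fun j t => FoldExt n s t ∧ (t.Closed n ∨
      i * (n * n) + j * n ≤ (t.marked n).card)) (by simpa using ht) fun j _ t ht => ?_
    rw [Nat.succ_mul, ← add_assoc]
    refine Cmd.exec_loop_induction (by simp) (fun k t => FoldExt n s t ∧ (t.Closed n ∨
      i * (n * n) + j * n + k ≤ (t.marked n).card)) (by simpa using ht) fun k _ t ht => ?_
    exact foldRound_progress (by simp) (by simp) (by simp) (by simp) ht
  refine ⟨key.1, key.2.resolve_right fun h => ?_⟩
  have h1 : ((foldAll.exec n (fun _ => 0) s).marked n).card ≤ n * n := by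
    refine (Finset.card_filter_le _ _).trans ?_
    simp
  -- There are `n³` rounds but only `n²` pairs; this is contradictory because `n ≥ 2`.
  nlinarith

end FoldAll

/-! ### Breadth-first search by layers, with a path label stored for each marked entry. -/

section Layers

/-- `Reach n ed E e u p`: starting from the vertex `e`, one gets to `p` along edges with labels
`ed` that spell the word `u`, where at any time one may pass to a vertex that is related by `E`. -/
inductive Reach (n : ℕ) (ed : ℕ → ℕ → Sym L) (E : ℕ → ℕ → Prop) (e : ℕ) : List L → ℕ → Prop
  | nil {p : ℕ} : p < n → E e p → Reach n ed E e [] p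
  | snoc {u : List L} {p q r : ℕ} {y : L} : Reach n ed E e u p → q < n → ed p q = letter y →
      r < n → E q r → Reach n ed E e (u ++ [y]) r

theorem Reach.lt {n : ℕ} {ed : ℕ → ℕ → Sym L} {E : ℕ → ℕ → Prop} {e : ℕ} {u : List L} {p : ℕ}
    (h : Reach n ed E e u p) : p < n := by
  cases h <;> assumption

/-- Copy the word of the vertex number 1 in layer 0 to the vertex number 3 in the next layer, and
append the letter `y`. -/
def extendWord (y : L) : ACmd L :=
  .seq
    (.loop 4 <| .case .word (pos₃ 0 1 4) fun c =>
      .set .word ((none, 2) :: pos₃ 0 3 4) c)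
    -- The last index is the layer number, which is the length of the copied word, so the letter is
    -- appended at its end.
    (.set .word ((none, 2) :: pos₃ 0 3 0) (letter y))

/-- Compute the layers: the entry `(k, p)` of the table is marked if the vertex `p` can be reached
by a word of length `k`, and then such a word is stored in `word`. -/
def layers : ACmd L :=
  .seq
    (.loop 0 <| ifMark .start (pos₁ 0) <| .loop 1 <| ifMark .fold (pos₂ 0 1) <|
      .set .layer (pos₁ 1) mark)
    (.loop 0 <| .loop 1 <| ifMark .layer (pos₂ 0 1) <| .loop 2 <| ifLetter .edge (pos₂ 1 2) fun y =>
      .loop 3 <| ifMark .fold (pos₂ 2 3) <|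
        .seq (.set .layer ((none, 1) :: pos₂ 0 3) mark) (extendWord y))

/-- The entry number `j` of the word for the vertex `p` in layer `k`. -/
def Store.wordAt (n : ℕ) (s : Store Arr (Sym L)) (k p j : ℕ) : Sym L :=
  s.arr .word ((k * n + p) * n + j)

/-- The words that are stored for the marked entries of the layers are correct. -/
def Store.WordsOK (n : ℕ) (R : List L → ℕ → Prop) (s : Store Arr (Sym L)) : Prop :=
  (∀ p < n, ∀ j < n, s.wordAt n 0 p j = none) ∧ ∀ k, ∀ p < n, s.tab n .layer k p = mark →
    ∃ u, R u p ∧ u.length = k ∧ ∀ j < n, s.wordAt n k p j = (u[j]?).map some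

theorem offset_succ_pos₂ {n : ℕ} {env : Fin 7 → ℕ} {u v : Fin 7} (hu : env u < n)
    (hv : env v < n) : offset n env ((none, 1) :: pos₂ u v) = (env u + 1) * n + env v := by
  have : offset n env ((none, 1) :: pos₂ u v) = n ^ 1 * 1 + offset n env (pos₂ u v) := rfl
  rw [this, offset_pos₂ hu hv]
  ring

theorem offset_succ_pos₃ {n : ℕ} {env : Fin 7 → ℕ} {u v w : Fin 7} (hu : env u < n)
    (hv : env v < n) (hw : env w < n) :
    offset n env ((none, 2) :: pos₃ u v w) = ((env u + 1) * n + env v) * n + env w := by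
  have : offset n env ((none, 2) :: pos₃ u v w) = n ^ 2 * 1 + offset n env (pos₃ u v w) := rfl
  rw [this, offset_pos₃ hu hv hw]
  ring

/-- Source and target lie in different layers, so copying never reads an overwritten entry. All `n`
entries are copied, blanks included, which erases any word stored earlier at the target. -/
theorem extendWord_spec {n k p r : ℕ} {env : Fin 7 → ℕ} (hk : k < n) (hp : p < n) (hr : r < n)
    (h0 : env 0 = k) (h1 : env 1 = p) (h3 : env 3 = r) (h4 : env 4 = 0) (y : L)
    (s : Store Arr (Sym L)) :
    (∀ a ≠ .word, ((extendWord y).exec n env s).arr a = s.arr a) ∧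
    ((extendWord y).exec n env s).out = s.out ∧
    (∀ k' p' j, p' < n → j < n → (k' ≠ k + 1 ∨ p' ≠ r) →
      ((extendWord y).exec n env s).wordAt n k' p' j = s.wordAt n k' p' j) ∧
    ∀ j < n, ((extendWord y).exec n env s).wordAt n (k + 1) r j =
      if j = k then letter y else s.wordAt n k p j := by
  set P : ACmd L := .loop 4 <| .case .word (pos₃ 0 1 4) fun c =>
      .set .word ((none, 2) :: pos₃ 0 3 4) c with hP
  have word_set : ∀ (t : Store Arr (Sym L)) (c : Sym L) (i k' p' j : ℕ), i < n → p' < n → j < n →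
      Store.wordAt n (t.put .word (((k + 1) * n + r) * n + i) c) k' p' j =
      if k' = k + 1 ∧ p' = r ∧ j = i then c else t.wordAt n k' p' j := by
    intro t c i k' p' j hi hp' hj
    simp only [Store.wordAt, Store.put_arr, update_self, update_apply, table_inj hj hi, table_inj hp' hr,
      and_assoc]
  have A : (∀ a ≠ .word, (P.exec n env s).arr a = s.arr a) ∧ (P.exec n env s).out = s.out ∧
      (∀ k' p' j, p' < n → j < n → (k' ≠ k + 1 ∨ p' ≠ r) →
        (P.exec n env s).wordAt n k' p' j = s.wordAt n k' p' j) ∧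
      ∀ j < n, (P.exec n env s).wordAt n (k + 1) r j = s.wordAt n k p j := by
    have := Cmd.exec_loop_induction (n := n) (P := .case .word (pos₃ 0 1 4) fun c =>
      .set .word ((none, 2) :: pos₃ 0 3 4) c) (s := s) h4 (fun i t =>
      (∀ a ≠ .word, t.arr a = s.arr a) ∧ t.out = s.out ∧
      (∀ k' p' j, p' < n → j < n → (k' ≠ k + 1 ∨ p' ≠ r) →
        t.wordAt n k' p' j = s.wordAt n k' p' j) ∧
      ∀ j < i, j < n → t.wordAt n (k + 1) r j = s.wordAt n k p j)
      ⟨fun _ _ => rfl, rfl, fun _ _ _ _ _ _ => rfl, by simp⟩ ?_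
    · exact ⟨this.1, this.2.1, this.2.2.1, fun j hj => this.2.2.2 j hj hj⟩
    rintro i hi t ⟨t1, t2, t3, t4⟩
    set env' := update env 4 i with henv'
    have e0 : env' 0 = k := by simp [henv', h0]
    have e1 : env' 1 = p := by simp [henv', h1]
    have e3 : env' 3 = r := by simp [henv', h3]
    have e4 : env' 4 = i := by simp [henv']
    have o1 : offset n env' (pos₃ 0 1 4) = (k * n + p) * n + i := by
      rw [offset_pos₃] <;> simp [*]
    have o2 : offset n env' ((none, 2) :: pos₃ 0 3 4) = ((k + 1) * n + r) * n + i := by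
      rw [offset_succ_pos₃] <;> simp [*]
    simp only [Cmd.exec, o1, o2]
    refine ⟨fun a ha => by simp [ha, t1], t2, fun k' p' j hp' hj h => ?_, fun j hj hj' => ?_⟩
    · rw [word_set _ _ _ _ _ _ hi hp' hj, if_neg (by tauto), t3 k' p' j hp' hj h]
    · rw [word_set _ _ _ _ _ _ hi hr hj']
      split_ifs with hc
      · rw [hc.2.2]
        exact t3 k p i hp hi (Or.inl (by omega))
      · exact t4 j (by omega) hj'
  have o : offset n env ((none, 2) :: pos₃ 0 3 0) = ((k + 1) * n + r) * n + k := by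
    rw [offset_succ_pos₃] <;> simp [*]
  have e : (extendWord y).exec n env s = (P.exec n env s).put .word
      (((k + 1) * n + r) * n + k) (letter y) := by
    rw [← o]
    rfl
  obtain ⟨A1, A2, A3, A4⟩ := A
  rw [e]
  refine ⟨fun a ha => by simp [ha, A1], A2, fun k' p' j hp' hj h => ?_, fun j hj => ?_⟩
  · rw [word_set _ _ _ _ _ _ hk hp' hj, if_neg (by tauto), A3 k' p' j hp' hj h]
  · rw [word_set _ _ _ _ _ _ hk hr hj, A4 j hj]
    simp

/-- `t` arises from `s` by marking further entries of the layers, with correct words. -/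
structure LayerExt (n : ℕ) (R : List L → ℕ → Prop) (s t : Store Arr (Sym L)) : Prop where
  arr : ∀ a, a ≠ .layer → a ≠ .word → t.arr a = s.arr a
  out : t.out = s.out
  mono : ∀ k, ∀ p < n, s.tab n .layer k p = mark → t.tab n .layer k p = mark
  words : s.WordsOK n R → t.WordsOK n R

theorem LayerExt.refl {n : ℕ} {R : List L → ℕ → Prop} (s : Store Arr (Sym L)) :
    LayerExt n R s s :=
  ⟨fun _ _ _ => rfl, rfl, fun _ _ _ h => h, fun h => h⟩

theorem LayerExt.trans {n : ℕ} {R : List L → ℕ → Prop} (s t u : Store Arr (Sym L))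
    (h₁ : LayerExt n R s t) (h₂ : LayerExt n R t u) : LayerExt n R s u :=
  ⟨fun a ha ha' => (h₂.arr a ha ha').trans (h₁.arr a ha ha'), h₂.out.trans h₁.out,
    fun k p hp h => h₂.mono k p hp (h₁.mono k p hp h), fun h => h₂.words (h₁.words h)⟩

theorem LayerExt.tab {n : ℕ} {R : List L → ℕ → Prop} {s t : Store Arr (Sym L)}
    (h : LayerExt n R s t) {a : Arr} (ha : a ≠ .layer) (ha' : a ≠ .word) :
    t.tab n a = s.tab n a := by
  funext p q
  simp [Store.tab, h.arr a ha ha']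

theorem Store.tab_set_layer {n k r : ℕ} (hr : r < n) (t : Store Arr (Sym L)) (k' p' : ℕ)
    (hp' : p' < n) :
    (t.put .layer (k * n + r) mark).tab n .layer k' p' = if k' = k ∧ p' = r then mark else t.tab n .layer k' p' := by
  simp only [Store.tab, Store.put_arr, update_self, update_apply, table_inj hp' hr]

/-- The target may already be marked and hold another word. Replacing it does no harm, since any
correct word of the right length will do. -/
theorem layerStep_spec {n k p q r : ℕ} {env : Fin 7 → ℕ} (hk : k < n) (hp : p < n) (hr : r < n)
    (h0 : env 0 = k) (h1 : env 1 = p) (h3 : env 3 = r) (h4 : env 4 = 0) {y : L}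
    {s : Store Arr (Sym L)} {ed : ℕ → ℕ → Sym L} {E : ℕ → ℕ → Prop} {e : ℕ} (hq : q < n)
    (hlay : s.tab n .layer k p = mark) (hed : ed p q = letter y) (hE : E q r) :
    LayerExt n (Reach n ed E e) s
      ((Cmd.seq (.set .layer ((none, 1) :: pos₂ 0 3) mark) (extendWord y)).exec n env s) ∧
    ((Cmd.seq (.set .layer ((none, 1) :: pos₂ 0 3) mark) (extendWord y)).exec n env s).tab n
      .layer (k + 1) r = mark := by
  have o : offset n env ((none, 1) :: pos₂ 0 3) = (k + 1) * n + r := by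
    rw [offset_succ_pos₂] <;> simp [*]
  set s₁ : Store Arr (Sym L) := s.put .layer ((k + 1) * n + r) mark with hs₁
  have e1 : (Cmd.seq (.set .layer ((none, 1) :: pos₂ 0 3) mark) (extendWord y)).exec n env s =
      (extendWord y).exec n env s₁ := by
    rw [hs₁, ← o]
    rfl
  have tab1 : ∀ k' p', p' < n → s₁.tab n .layer k' p' =
      if k' = k + 1 ∧ p' = r then mark else s.tab n .layer k' p' := fun k' p' hp' =>
    Store.tab_set_layer hr s k' p' hp'
  have word1 : ∀ k' p' j, s₁.wordAt n k' p' j = s.wordAt n k' p' j := by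
    intro k' p' j
    simp [Store.wordAt, hs₁]
  obtain ⟨B1, B2, B3, B4⟩ := extendWord_spec hk hp hr h0 h1 h3 h4 y s₁
  rw [e1]
  set s₂ := (extendWord y).exec n env s₁
  have tab2 : ∀ k' p', p' < n → s₂.tab n .layer k' p' =
      if k' = k + 1 ∧ p' = r then mark else s.tab n .layer k' p' := by
    intro k' p' hp'
    rw [← tab1 k' p' hp', Store.tab, B1 _ (by simp), Store.tab]
  refine ⟨⟨fun a ha ha' => ?_, B2, fun k' p' hp' h => ?_,
    fun ⟨hW0, hW⟩ => ⟨fun p' hp' j hj => ?_, fun k' p' hp' h => ?_⟩⟩, ?_⟩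
  · rw [B1 a ha']
    simp [hs₁, ha]
  · rw [tab2 k' p' hp']
    split_ifs
    · rfl
    · exact h
  · rw [B3 0 p' j hp' hj (Or.inl (by omega)), word1, hW0 p' hp' j hj]
  · by_cases hc : k' = k + 1 ∧ p' = r
    · obtain ⟨rfl, rfl⟩ := hc
      obtain ⟨u, hu, hlen, hw⟩ := hW k p hp hlay
      refine ⟨u ++ [y], .snoc hu hq hed hr hE, by simp [hlen], fun j hj => ?_⟩
      rw [B4 j hj]
      split_ifs with hjk
      · simp [hjk, ← hlen]
      · rw [word1, hw j hj]
        rcases lt_or_gt_of_ne hjk with h' | h'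
        · rw [List.getElem?_append_left (by omega)]
        · rw [List.getElem?_eq_none (by omega), List.getElem?_eq_none (by simp; omega)]
    · rw [tab2 k' p' hp', if_neg hc] at h
      obtain ⟨u, hu, hlen, hw⟩ := hW k' p' hp' h
      refine ⟨u, hu, hlen, fun j hj => ?_⟩
      rw [B3 k' p' j hp' hj (by tauto), word1, hw j hj]
  · rw [tab2 _ _ hr, if_pos ⟨rfl, rfl⟩]

/-- Correctness of the stored words is carried along by `LayerExt`. Completeness is an induction on
the layer: splitting off the last edge of a path leads from a marked entry of layer `k` to layer `k
+ 1`. -/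
theorem layers_spec {n e : ℕ} (he : e < n) {s : Store Arr (Sym L)}
    (hstart : ∀ p < n, s.arr .start p = mark ↔ p = e) (hlay : s.arr .layer = fun _ => none)
    (hword : s.arr .word = fun _ => none) :
    let t := layers.exec n (fun _ => 0) s
    let R := Reach n (s.tab n .edge) (fun p q => s.tab n .fold p q = mark) e
    (∀ a, a ≠ .layer → a ≠ .word → t.arr a = s.arr a) ∧ t.out = s.out ∧ t.WordsOK n R ∧
      ∀ u p, R u p → u.length ≤ n → t.tab n .layer u.length p = mark := by
  intro t R
  set P₁ : ACmd L := .loop 0 <| ifMark .start (pos₁ 0) <| .loop 1 <| ifMark .fold (pos₂ 0 1) <|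
      .set .layer (pos₁ 1) mark with hP₁
  set P₂ : ACmd L := .loop 0 <| .loop 1 <| ifMark .layer (pos₂ 0 1) <| .loop 2 <|
    ifLetter .edge (pos₂ 1 2) fun y => .loop 3 <| ifMark .fold (pos₂ 2 3) <|
        .seq (.set .layer ((none, 1) :: pos₂ 0 3) mark) (extendWord y) with hP₂
  have ht : t = P₂.exec n (fun _ => 0) (P₁.exec n (fun _ => 0) s) := rfl
  have hs : s.WordsOK n R :=
    ⟨fun p _ j _ => by simp [Store.wordAt, hword], fun k p hp h => by simp [Store.tab, hlay] at h⟩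
  have A : LayerExt n R s (P₁.exec n (fun _ => 0) s) ∧ ∀ i < n, i = e → ∀ p < n, p < n →
      s.tab n .fold e p = mark → (P₁.exec n (fun _ => 0) s).tab n .layer 0 p = mark := by
    refine Cmd.exec_loop_achieve (by rfl) (LayerExt n R) LayerExt.refl LayerExt.trans
      (fun i t => i = e → ∀ p < n, p < n → s.tab n .fold e p = mark → t.tab n .layer 0 p = mark)
      (fun i t u htu h hi p hp hp' hf => htu.mono 0 p hp (h hi p hp hp' hf)) ?_
    intro i hi t₁ ht₁
    have o : offset n (update (fun _ => 0) (0 : Fin 7) i) (pos₁ 0) = i := by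
      rw [offset_pos₁] <;> simp [hi]
    by_cases c : i = e
    · subst c
      have c' : t₁.arr .start i = mark := by
        rw [ht₁.arr _ (by simp) (by simp)]
        exact (hstart i hi).2 rfl
      rw [exec_ifMark_pos (by rw [o]; exact c')]
      refine (Cmd.exec_loop_achieve (by simp) (LayerExt n R) LayerExt.refl LayerExt.trans
        (fun p t => p < n → s.tab n .fold i p = mark → t.tab n .layer 0 p = mark)
        (fun p t u htu h hp hf => htu.mono 0 p hp (h hp hf)) ?_).imp_right fun h _ => h
      intro p hp t₂ ht₂
      have ht₂ := LayerExt.trans _ _ _ ht₁ ht₂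
      set env' := update (update (fun _ => 0) (0 : Fin 7) i) 1 p with henv'
      have e0 : env' 0 = i := by simp [henv']
      have e1 : env' 1 = p := by simp [henv']
      have o1 : offset n env' (pos₂ 0 1) = i * n + p := by rw [offset_pos₂] <;> simp [*]
      have o2 : offset n env' (pos₁ 1) = 0 * n + p := by rw [offset_pos₁] <;> simp [*]
      by_cases c2 : s.tab n .fold i p = mark
      · have c3 := c2
        rw [← ht₂.tab (by simp) (by simp)] at c3
        rw [exec_ifMark_pos (by rw [o1]; exact c3)]
        simp only [Cmd.exec, o2]
        have key := Store.tab_set_layer (k := 0) hp t₂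
        have word0 : ∀ k p' j, (t₂.put .layer (0 * n + p) mark).wordAt n k p' j =
            t₂.wordAt n k p' j := by
          intro k p' j
          simp [Store.wordAt]
        refine ⟨⟨fun a ha ha' => by simp [ha], rfl, fun k' p' hp' h => ?_,
          fun ⟨hW0, hW⟩ => ⟨fun p' hp' j hj => ?_, fun k' p' hp' h => ?_⟩⟩, fun _ _ => ?_⟩
        · rw [key k' p' hp']
          split_ifs
          · rfl
          · exact h
        · rw [word0]
          exact hW0 p' hp' j hj
        · rw [key k' p' hp'] at h
          by_cases hc : k' = 0 ∧ p' = p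
          · obtain ⟨rfl, rfl⟩ := hc
            refine ⟨[], .nil hp' c2, rfl, fun j hj => ?_⟩
            rw [word0, hW0 p' hp' j hj]
            rfl
          · rw [if_neg hc] at h
            obtain ⟨u, hu, hlen, hw⟩ := hW k' p' hp' h
            refine ⟨u, hu, hlen, fun j hj => ?_⟩
            rw [word0, hw j hj]
        · rw [key _ _ hp, if_pos ⟨rfl, rfl⟩]
      · have c3 := c2
        rw [← ht₂.tab (by simp) (by simp)] at c3
        rw [exec_ifMark_neg (by rw [o1]; exact c3)]
        exact ⟨LayerExt.refl _, fun _ h => absurd h c2⟩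
    · have c' : t₁.arr .start i ≠ mark := by
        rw [ht₁.arr _ (by simp) (by simp)]
        exact fun h => c ((hstart i hi).1 h)
      rw [exec_ifMark_neg (by rw [o]; exact c')]
      exact ⟨LayerExt.refl _, fun h => absurd h c⟩
  set s₁ := P₁.exec n (fun _ => 0) s
  have B : LayerExt n R s (P₂.exec n (fun _ => 0) s₁) ∧ ∀ u p, R u p → u.length ≤ n →
      (P₂.exec n (fun _ => 0) s₁).tab n .layer u.length p = mark := by
    refine Cmd.exec_loop_induction (by rfl) (fun k t => LayerExt n R s t ∧ ∀ u p, R u p →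
      u.length ≤ k → t.tab n .layer u.length p = mark) ⟨A.1, fun u p hu hk => ?_⟩ ?_
    · cases hu with
      | nil hp hE => exact A.2 e he rfl p hp hp hE
      | snoc => simp at hk
    rintro k hk t₁ ⟨ht₁, hc₁⟩
    have C : LayerExt n R t₁ ((Cmd.loop 1 <| ifMark .layer (pos₂ 0 1) <| .loop 2 <|
        ifLetter .edge (pos₂ 1 2) fun y => .loop 3 <| ifMark .fold (pos₂ 2 3) <|
        .seq (.set .layer ((none, 1) :: pos₂ 0 3) mark) (extendWord y)).exec n
          (update (fun _ => 0) (0 : Fin 7) k) t₁) ∧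
        ∀ p < n, t₁.tab n .layer k p = mark → ∀ q < n, ∀ y, s.tab n .edge p q = letter y →
          ∀ r < n, r < n → s.tab n .fold q r = mark →
          ((Cmd.loop 1 <| ifMark .layer (pos₂ 0 1) <| .loop 2 <|
            ifLetter .edge (pos₂ 1 2) fun y => .loop 3 <| ifMark .fold (pos₂ 2 3) <|
            .seq (.set .layer ((none, 1) :: pos₂ 0 3) mark) (extendWord y)).exec n
              (update (fun _ => 0) (0 : Fin 7) k) t₁).tab n .layer (k + 1) r = mark := by
      refine Cmd.exec_loop_achieve (by simp) (LayerExt n R) LayerExt.refl LayerExt.trans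
        (fun p t => t₁.tab n .layer k p = mark → ∀ q < n, ∀ y, s.tab n .edge p q = letter y →
          ∀ r < n, r < n → s.tab n .fold q r = mark → t.tab n .layer (k + 1) r = mark)
        (fun p t u htu h h1 q hq y hy r hr hr' hf =>
          htu.mono _ r hr (h h1 q hq y hy r hr hr' hf)) ?_
      intro p hp t₂ ht₂
      have o : offset n (update (update (fun _ => 0) (0 : Fin 7) k) 1 p) (pos₂ 0 1) =
          k * n + p := by
        rw [offset_pos₂] <;> simp [*]
      by_cases c : t₂.tab n .layer k p = mark
      swap
      · rw [exec_ifMark_neg (by rw [o]; exact c)]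
        exact ⟨LayerExt.refl _, fun h => absurd (ht₂.mono k p hp h) c⟩
      rw [exec_ifMark_pos (by rw [o]; exact c)]
      refine (Cmd.exec_loop_achieve (by simp) (LayerExt n R) LayerExt.refl LayerExt.trans
        (fun q t => ∀ y, s.tab n .edge p q = letter y →
          ∀ r < n, r < n → s.tab n .fold q r = mark → t.tab n .layer (k + 1) r = mark)
        (fun q t u htu h y hy r hr hr' hf =>
          htu.mono _ r hr (h y hy r hr hr' hf)) ?_).imp_right fun h _ => h
      intro q hq t₃ ht₃
      have ht₁₃ := LayerExt.trans _ _ _ ht₂ ht₃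
      have ht₀₃ := LayerExt.trans _ _ _ ht₁ ht₁₃
      have o : offset n (update (update (update (fun _ => 0) (0 : Fin 7) k) 1 p) 2 q)
          (pos₂ 1 2) = p * n + q := by
        rw [offset_pos₂] <;> simp [*]
      by_cases c2 : ∃ y, s.tab n .edge p q = letter y
      swap
      · rw [exec_ifLetter_neg (by
          rw [o]
          intro y hy
          rw [← ht₀₃.tab (by simp) (by simp)] at c2
          exact c2 ⟨y, hy⟩)]
        exact ⟨LayerExt.refl _, fun y h => absurd ⟨y, h⟩ c2⟩
      obtain ⟨y, c2⟩ := c2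
      rw [exec_ifLetter_pos (y := y) (by
        rw [o]
        rw [← ht₀₃.tab (by simp) (by simp)] at c2
        exact c2)]
      refine (Cmd.exec_loop_achieve (by simp) (LayerExt n R) LayerExt.refl LayerExt.trans
        (fun r t => r < n → s.tab n .fold q r = mark → t.tab n .layer (k + 1) r = mark)
        (fun r t u htu h hr hf => htu.mono _ r hr (h hr hf)) ?_).imp_right fun h _ _ => h
      intro r hr t₄ ht₄
      have ht₀₄ := LayerExt.trans _ _ _ ht₀₃ ht₄
      have o : offset n (update (update (update (update (fun _ => 0) (0 : Fin 7) k) 1 p) 2 q) 3 r)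
          (pos₂ 2 3) = q * n + r := by
        rw [offset_pos₂] <;> simp [*]
      have efold := ht₀₄.tab (a := .fold) (by simp) (by simp)
      by_cases c3 : s.tab n .fold q r = mark
      swap
      · rw [exec_ifMark_neg (by
          rw [o]
          rw [← efold] at c3
          exact c3)]
        exact ⟨LayerExt.refl _, fun _ h => absurd h c3⟩
      rw [exec_ifMark_pos (by
        rw [o]
        rw [← efold] at c3
        exact c3)]
      refine (layerStep_spec (q := q) hk hp hr (by simp) (by simp) (by simp) (by simp) hq
        (ht₄.mono k p hp (ht₃.mono k p hp c)) c2 c3).imp_right fun h _ _ => h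
    refine ⟨LayerExt.trans _ _ _ ht₁ C.1, fun u p hu hlen => ?_⟩
    rcases Nat.lt_or_ge u.length (k + 1) with h | h
    · exact C.1.mono _ p hu.lt (hc₁ u p hu (by omega))
    · cases hu with
      | nil => simp at h
      | snoc hu hq hy hr hE =>
        rename_i u' _ _ _
        have hl : u'.length = k := by simpa using le_antisymm hlen h
        have := C.2 _ hu.lt (hl ▸ hc₁ _ _ hu hl.le) _ hq _ hy _ hr hr hE
        simpa [hl] using this
  exact ⟨B.1.arr, B.1.out, B.1.words hs, B.2⟩

end Layers

end ClosestElement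

namespace ClosestElement

open Function ACmd

variable {L : Type}

/-! ### Reading off a shortest path. -/

section Output

/-- Write the word for the base vertex in the first layer in which this vertex is marked. -/
def outputWord : ACmd L :=
  .loop 0 <| .case .done [] fun
    | none => ifMark .layer [(some 0, 1)] <| .seq (.set .done [] mark) <|
        .loop 1 <| ifLetter .word [(some 0, 2), (some 1, 0)] fun y => .emit (letter y)
    | some _ => .skip

/-- The cell `done` makes up for the missing early exit from a loop: it is blank exactly as long as
no layer with the base vertex has been found, and the later rounds do nothing. -/
theorem outputWord_spec {n : ℕ} {R : List L → ℕ → Prop} {s : Store Arr (Sym L)}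
    (hW : s.WordsOK n R) (hdone : s.arr .done 0 = none)
    (hex : ∃ k < n, s.tab n .layer k 0 = mark) :
    ∃ u, R u 0 ∧ (outputWord.exec n (fun _ => 0) s).out = u.reverse.map letter ++ s.out ∧
      ∀ j < u.length, s.tab n .layer j 0 ≠ mark := by
  have key := Cmd.exec_loop_induction (n := n) (env := fun _ => 0) (v := (0 : Fin 7)) (s := s)
    (P := .case .done [] fun
    | none => ifMark .layer [(some 0, 1)] <| .seq (.set .done [] mark) <|
        .loop 1 <| ifLetter .word [(some 0, 2), (some 1, 0)] fun y => .emit (letter y)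
    | some _ => .skip) rfl
    (fun i t => (∀ a ≠ .done, t.arr a = s.arr a) ∧
      ((t.arr .done 0 = none ∧ t.out = s.out ∧ ∀ j < i, s.tab n .layer j 0 ≠ mark) ∨
      (t.arr .done 0 = mark ∧ ∃ u, R u 0 ∧ t.out = u.reverse.map letter ++ s.out ∧
        ∀ j < u.length, s.tab n .layer j 0 ≠ mark)))
    ⟨fun _ _ => rfl, Or.inl ⟨hdone, rfl, by simp⟩⟩ ?_
  · obtain ⟨-, ⟨-, -, h⟩ | ⟨-, h⟩⟩ := key
    · obtain ⟨k, hk, hk'⟩ := hex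
      exact absurd hk' (h k hk)
    · exact h
  rintro i hi t ⟨ht, ⟨h1, h2, h3⟩ | ⟨h1, h2⟩⟩
  swap
  · have e : ∀ (f : Sym L → ACmd L) (env : Fin 7 → ℕ), (Cmd.case .done [] f).exec n env t =
        (f mark).exec n env t := by
      intro f env
      simp [Cmd.exec, offset, h1]
    rw [e]
    exact ⟨ht, Or.inr ⟨h1, h2⟩⟩
  have e : ∀ (f : Sym L → ACmd L) (env : Fin 7 → ℕ), (Cmd.case .done [] f).exec n env t =
      (f none).exec n env t := by
    intro f env
    simp [Cmd.exec, offset, h1]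
  rw [e]
  have hn : 0 < n := by omega
  have o : offset n (update (fun _ => 0) (0 : Fin 7) i) [(some 0, 1)] = i * n + 0 := by
    simp [offset, hi.le, mul_comm]
  have elay : t.arr .layer (i * n + 0) = s.tab n .layer i 0 := by
    rw [ht _ (by simp), Store.tab]
  by_cases c : s.tab n .layer i 0 = mark
  swap
  · rw [exec_ifMark_neg (by rw [o, elay]; exact c)]
    refine ⟨ht, Or.inl ⟨h1, h2, fun j hj => ?_⟩⟩
    rcases Nat.lt_succ_iff_lt_or_eq.1 hj with hj | rfl
    · exact h3 j hj
    · exact c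
  rw [exec_ifMark_pos (by rw [o, elay]; exact c)]
  obtain ⟨u, hu, hlen, hw⟩ := hW.2 i 0 hn c
  set env₁ : Fin 7 → ℕ := update (fun _ => 0) 0 i with henv₁
  set t₁ := t.put .done 0 mark with ht₁
  have e1 : ∀ Q : ACmd L, (Cmd.seq (.set .done [] mark) Q).exec n env₁ t = Q.exec n env₁ t₁ :=
    fun Q => rfl
  rw [e1]
  have key := Cmd.exec_loop_induction (n := n) (env := env₁) (v := (1 : Fin 7)) (s := t₁)
    (P := ifLetter .word [(some 0, 2), (some 1, 0)] fun y => .emit (letter y)) rfl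
    (fun j t' => t'.arr = t₁.arr ∧ t'.out = (u.take j).reverse.map letter ++ s.out)
    ⟨rfl, by simp [ht₁, h2]⟩ ?_
  · refine ⟨fun a ha => ?_, Or.inr ⟨?_, u, hu, ?_, fun j hj => h3 j (by omega)⟩⟩
    · rw [key.1, ht₁, Store.put_arr, update_of_ne ha, ht a ha]
    · rw [key.1]
      simp [ht₁]
    · rw [key.2, List.take_of_length_le (by omega)]
  rintro j hj t' ⟨ha, ho⟩
  have o2 : offset n (update env₁ 1 j) [(some 0, 2), (some 1, 0)] = (i * n + 0) * n + j := by
    simp [offset, henv₁, hi.le, hj.le]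
    ring
  have ew : t'.arr .word ((i * n + 0) * n + j) = (u[j]?).map some := by
    rw [← hw j hj, ha, ht₁, Store.put_arr, update_of_ne (by simp), ht _ (by simp)]
    rfl
  rcases hj' : u[j]? with _ | y
  · rw [exec_ifLetter_neg (by rw [o2, ew, hj']; simp)]
    have : u.length ≤ j := List.getElem?_eq_none_iff.1 hj'
    rw [List.take_of_length_le (by omega)] at ho ⊢
    exact ⟨ha, ho⟩
  · rw [exec_ifLetter_pos (y := y) (by rw [o2, ew, hj']; rfl)]
    refine ⟨ha, ?_⟩
    simp only [Cmd.exec, ho, List.take_add_one, hj']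
    simp

end Output

/-! ### Reading the input and building the unfolded graph. -/

section Setup

/-- Read the input: write the first word, enter the edges of the graph, the end of the first word
as the starting vertex, and relate the ends of the other words to the base vertex. -/
def setup (inv : L → L) : ACmd L :=
  .loop 0 <| .seq (.set .fold (pos₂ 0 0) mark) <| .case .inp (pos₁ 0) fun
    | none => .skip
    | some none =>
      .seq
        (.case .seen [] fun
          | none => .seq (.set .seen [] mark) (.set .start (pos₁ 0) mark)
          | some _ => .seq (.set .fold [(some 0, 1)] mark) (.set .fold (pos₁ 0) mark))
        (.seq (.set .fold [(none, 1), (some 0, 1)] mark) (.set .fold ((none, 0) :: pos₁ 0) mark))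
    | some (some y) =>
      .seq (.set .edge ((none, 0) :: pos₂ 0 0) (letter y)) <|
        .seq (.set .edge ((none, 1) :: pos₂ 0 0) (letter (inv y))) <|
          .case .seen [] fun
            | none => .emit (letter y)
            | some _ => .skip

/-- The vertex `p` is an end of a word other than the first one; here `x` is the input, the first
word has length `e`, and only the first `i` symbols of the input are taken into account. -/
def IsBase (x : List (Option L)) (e i p : ℕ) : Prop :=
  (p < i ∧ x[p]? = some none ∧ p ≠ e) ∨ ∃ p', p = p' + 1 ∧ p' < i ∧ x[p']? = some none

/-- The initial fold relation. -/
def Linked (x : List (Option L)) (e i p q : ℕ) : Prop :=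
  (p = q ∧ p < i) ∨ (q = 0 ∧ IsBase x e i p) ∨ (p = 0 ∧ IsBase x e i q)

/-- The edges of the graph. -/
def IsEdge (inv : L → L) (x : List (Option L)) (i p q : ℕ) (y : L) : Prop :=
  (q = p + 1 ∧ p < i ∧ x[p]? = some (some y)) ∨
    (p = q + 1 ∧ q < i ∧ ∃ z, x[q]? = some (some z) ∧ inv z = y)

/-- The state after the first `i` symbols of the input `x` have been read, where the first word is
`g`. -/
structure SetupInv (n : ℕ) (inv : L → L) (x : List (Option L)) (g : List L) (i : ℕ)
    (s : Store Arr (Sym L)) : Prop where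
  inp : ∀ j, s.arr .inp j = x[j]?
  seen : s.arr .seen 0 = if i ≤ g.length then none else mark
  start : ∀ j, s.arr .start j = mark ↔ j = g.length ∧ j < i
  edge : ∀ p < n, ∀ q < n, ∀ y, s.tab n .edge p q = letter y ↔ IsEdge inv x i p q y
  fold : ∀ p < n, ∀ q < n, s.tab n .fold p q = mark ↔ Linked x g.length i p q
  layer : s.arr .layer = fun _ => none
  word : s.arr .word = fun _ => none
  done : s.arr .done = fun _ => none
  out : s.out = (g.take i).reverse.map letter

theorem isBase_succ {x : List (Option L)} {e i p : ℕ} : IsBase x e (i + 1) p ↔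
    IsBase x e i p ∨ (x[i]? = some none ∧ ((p = i ∧ i ≠ e) ∨ p = i + 1)) := by
  unfold IsBase
  grind

theorem linked_succ {x : List (Option L)} {e i p q : ℕ} : Linked x e (i + 1) p q ↔
    Linked x e i p q ∨ (p = i ∧ q = i) ∨ (x[i]? = some none ∧
      ((q = 0 ∧ ((p = i ∧ i ≠ e) ∨ p = i + 1)) ∨ (p = 0 ∧ ((q = i ∧ i ≠ e) ∨ q = i + 1)))) := by
  unfold Linked
  rw [isBase_succ, isBase_succ]
  grind

theorem isEdge_succ {inv : L → L} {x : List (Option L)} {i p q : ℕ} {y : L} :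
    IsEdge inv x (i + 1) p q y ↔ IsEdge inv x i p q y ∨ (p = i ∧ q = i + 1 ∧ x[i]? = some (some y)) ∨
      (p = i + 1 ∧ q = i ∧ ∃ z, x[i]? = some (some z) ∧ inv z = y) := by
  unfold IsEdge
  grind

theorem Store.tab_put_self {n p q p' q' : ℕ} (hq : q < n) (hq' : q' < n) (s : Store Arr (Sym L))
    (a : Arr) (c : Sym L) : (s.put a (p * n + q) c).tab n a p' q' =
      if p' = p ∧ q' = q then c else s.tab n a p' q' := by
  simp only [Store.tab, Store.put_arr, update_self, update_apply, table_inj hq' hq]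

theorem Store.tab_put_of_ne {n i : ℕ} {a b : Arr} (h : b ≠ a) (s : Store Arr (Sym L))
    (c : Sym L) (p q : ℕ) : (s.put a i c).tab n b p q = s.tab n b p q := by
  simp only [Store.tab, Store.put_arr, update_of_ne h]

theorem setup_spec {n : ℕ} (inv : L → L) {x : List (Option L)} {g : List L}
    {rest : List (Option L)} (hx : x = g.map some ++ none :: rest) (hn : n = x.length + 1) :
    SetupInv n inv x g n ((setup inv).exec n (fun _ => 0) (.init .inp (x.map some))) := by
  have hgn : g.length < n := by
    rw [hn, hx]
    simp
  have hxg : ∀ i < g.length, x[i]? = some g[i]? := by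
    intro i hi
    rw [hx, List.getElem?_append_left (by simpa using hi)]
    simp [hi]
  have hxe : x[g.length]? = some none := by
    rw [hx, List.getElem?_append_right (by simp)]
    simp
  -- This is why `n` exceeds the input length by one: position `i + 1` is still a vertex, so no
  -- table entry spills over into the next row.
  have hxn : ∀ {i c}, x[i]? = some c → i + 1 < n := by
    intro i c h
    obtain ⟨h, -⟩ := List.getElem?_eq_some_iff.1 h
    omega
  refine Cmd.exec_loop_induction (by rfl) (SetupInv n inv x g) ?_ ?_
  · refine ⟨fun j => ?_, ?_, fun j => ?_, fun p _ q _ y => ?_, fun p _ q _ => ?_, ?_, ?_, ?_, ?_⟩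
    · simp only [Store.init, update_self, List.getD_eq_getElem?_getD, List.getElem?_map]
      rcases x[j]? with _ | c <;> rfl
    · simp [Store.init]
      rfl
    · simp [Store.init]
    · simp [Store.init, Store.tab, IsEdge]
    · simp [Store.init, Store.tab, Linked, IsBase]
    · simp [Store.init]; rfl
    · simp [Store.init]; rfl
    · simp [Store.init]; rfl
    · simp [Store.init]
  intro i hi s hs
  set env : Fin 7 → ℕ := update (fun _ => 0) 0 i with henv
  have e0 : env 0 = i := by simp [henv]
  have o1 : offset n env (pos₁ 0) = i := by rw [offset_pos₁] <;> simp [e0, hi]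
  have o1' : offset n env (pos₁ 0) = 0 * n + i := by rw [o1]; omega
  have o2 : offset n env (pos₂ 0 0) = i * n + i := by rw [offset_pos₂] <;> simp [e0, hi]
  have o3 : offset n env [(some 0, 1)] = i * n + 0 := by simp [offset, e0, hi.le, mul_comm]
  have o4 : offset n env [(none, 1), (some 0, 1)] = (i + 1) * n + 0 := by
    simp [offset, e0, hi.le]
    ring
  have o5 : offset n env ((none, 0) :: pos₁ 0) = 0 * n + (i + 1) := by
    simp [offset, e0, hi.le, pos₁]
    ring
  have o6 : offset n env ((none, 0) :: pos₂ 0 0) = i * n + (i + 1) := by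
    simp [offset, e0, hi.le, pos₂]
    ring
  have o7 : offset n env ((none, 1) :: pos₂ 0 0) = (i + 1) * n + i := by
    simp [offset, e0, hi.le, pos₂]
    ring
  have o8 : offset n env [] = 0 := rfl
  have hn0 : 0 < n := by omega
  simp only [Cmd.exec, o2]
  set s₁ := s.put .fold (i * n + i) mark with hs₁
  have hinp : s₁.arr .inp (offset n env (pos₁ 0)) = x[i]? := by
    rw [o1, hs₁, Store.put_arr, update_of_ne (by simp), hs.inp]
  rw [hinp]
  rcases hxi : x[i]? with _ | _ | y
  · have hge : g.length < i := by
      by_contra hle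
      rcases Nat.lt_or_eq_of_le (not_lt.1 hle) with h | h
      · rw [hxg i h] at hxi
        cases hxi
      · rw [h, hxe] at hxi
        cases hxi
    change SetupInv n inv x g (i + 1) s₁
    refine ⟨fun j => ?_, ?_, fun j => ?_, fun p hp q hq z => ?_, fun p hp q hq => ?_, ?_, ?_, ?_, ?_⟩
    · simp [hs₁, hs.inp]
    · simp [hs₁, hs.seen, hge.le, not_le.2 hge]
    · simp only [hs₁, Store.put_arr, ne_eq, reduceCtorEq, not_false_eq_true, update_of_ne, hs.start]
      omega
    · rw [hs₁, Store.tab_put_of_ne (by simp), hs.edge p hp q hq, isEdge_succ]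
      simp [hxi]
    · rw [hs₁, Store.tab_put_self hi hq, linked_succ, ← hs.fold p hp q hq]
      simp only [hxi, reduceCtorEq, false_and, or_false]
      split_ifs with h <;> simp [h]
    · simp [hs₁, hs.layer]
    · simp [hs₁, hs.word]
    · simp [hs₁, hs.done]
    · rw [hs₁, Store.put_out, hs.out, List.take_of_length_le (by omega),
        List.take_of_length_le (by omega)]
  · have hi1 : i + 1 < n := hxn hxi
    have hge : g.length ≤ i := by
      by_contra hle
      rw [hxg i (not_le.1 hle)] at hxi
      simp at hxi
      omega
    rcases hge.eq_or_lt with hge | hge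
    · have hseen : s₁.arr .seen 0 = none := by simp [hs₁, hs.seen, hge]
      simp only [Cmd.exec, o8, hseen, o1, o4, o5]
      refine ⟨fun j => ?_, ?_, fun j => ?_, fun p hp q hq z => ?_, fun p hp q hq => ?_, ?_, ?_, ?_,
        ?_⟩
      · simp [hs₁, hs.inp]
      · simp [hge]
      · have h := hs.start j
        simp only [hs₁, Store.put_arr, ne_eq, reduceCtorEq, not_false_eq_true, update_of_ne,
          update_self, update_apply]
        grind
      · rw [Store.tab_put_of_ne (by simp), Store.tab_put_of_ne (by simp),
          Store.tab_put_of_ne (by simp), Store.tab_put_of_ne (by simp), hs₁,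
          Store.tab_put_of_ne (by simp), hs.edge p hp q hq, isEdge_succ]
        simp [hxi]
      · rw [Store.tab_put_self hi1 hq, Store.tab_put_self hn0 hq, Store.tab_put_of_ne (by simp),
          Store.tab_put_of_ne (by simp), hs₁, Store.tab_put_self hi hq, linked_succ,
          ← hs.fold p hp q hq]
        grind
      · simp [hs₁, hs.layer]
      · simp [hs₁, hs.word]
      · simp [hs₁, hs.done]
      · simp only [hs₁, Store.put_out, hs.out]
        rw [List.take_of_length_le (by omega), List.take_of_length_le (by omega)]
    · have hseen : s₁.arr .seen 0 = mark := by simp [hs₁, hs.seen, not_le.2 hge]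
      simp only [Cmd.exec, o8, hseen, o1', o3, o4, o5]
      refine ⟨fun j => ?_, ?_, fun j => ?_, fun p hp q hq z => ?_, fun p hp q hq => ?_, ?_, ?_, ?_,
        ?_⟩
      · simp [hs₁, hs.inp]
      · have h : ¬ i + 1 ≤ g.length := by omega
        simp [hs₁, hs.seen, h, not_le.2 hge]
      · have h := hs.start j
        simp only [hs₁, Store.put_arr, ne_eq, reduceCtorEq, not_false_eq_true, update_of_ne]
        grind
      · rw [Store.tab_put_of_ne (by simp), Store.tab_put_of_ne (by simp),
          Store.tab_put_of_ne (by simp), Store.tab_put_of_ne (by simp), hs₁,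
          Store.tab_put_of_ne (by simp), hs.edge p hp q hq, isEdge_succ]
        simp [hxi]
      · rw [Store.tab_put_self hi1 hq, Store.tab_put_self hn0 hq, Store.tab_put_self hi hq,
          Store.tab_put_self hn0 hq, hs₁, Store.tab_put_self hi hq, linked_succ,
          ← hs.fold p hp q hq]
        grind
      · simp [hs₁, hs.layer]
      · simp [hs₁, hs.word]
      · simp [hs₁, hs.done]
      · simp only [hs₁, Store.put_out, hs.out]
        rw [List.take_of_length_le (by omega), List.take_of_length_le (by omega)]
  · have hi1 : i + 1 < n := hxn hxi
    have hne : i ≠ g.length := by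
      rintro rfl
      rw [hxe] at hxi
      cases hxi
    set s₂ := (s₁.put .edge (i * n + (i + 1)) (letter y)).put .edge ((i + 1) * n + i)
      (letter (inv y)) with hs₂
    have base : ∀ s₃ : Store Arr (Sym L), s₃.arr = s₂.arr →
        s₃.out = (g.take (i + 1)).reverse.map letter → SetupInv n inv x g (i + 1) s₃ := by
      intro s₃ ha ho
      have htab : ∀ a p q, s₃.tab n a p q = s₂.tab n a p q := by
        intro a p q
        rw [Store.tab, Store.tab, ha]
      refine ⟨fun j => ?_, ?_, fun j => ?_, fun p hp q hq z => ?_, fun p hp q hq => ?_, ?_, ?_, ?_,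
        ho⟩
      · simp [ha, hs₂, hs₁, hs.inp]
      · have h : i ≤ g.length ↔ i + 1 ≤ g.length := by omega
        simp [ha, hs₂, hs₁, hs.seen, h]
      · have h := hs.start j
        simp only [ha, hs₂, hs₁, Store.put_arr, ne_eq, reduceCtorEq, not_false_eq_true,
          update_of_ne]
        grind
      · rw [htab, hs₂, Store.tab_put_self hi hq, Store.tab_put_self hi1 hq, hs₁,
          Store.tab_put_of_ne (by simp), isEdge_succ, ← hs.edge p hp q hq]
        have hno : ∀ z, IsEdge inv x i p q z → p < i + 1 ∧ q < i + 1 := by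
          unfold IsEdge
          grind
        have h := hs.edge p hp q hq
        grind
      · rw [htab, hs₂, Store.tab_put_of_ne (by simp), Store.tab_put_of_ne (by simp), hs₁,
          Store.tab_put_self hi hq, linked_succ, ← hs.fold p hp q hq]
        simp only [hxi, Option.some.injEq, reduceCtorEq, false_and, or_false]
        split_ifs with h <;> simp [h]
      · simp [ha, hs₂, hs₁, hs.layer]
      · simp [ha, hs₂, hs₁, hs.word]
      · simp [ha, hs₂, hs₁, hs.done]
    simp only [Cmd.exec, o6, o7, o8, ← hs₂]
    have hseen : s₂.arr .seen 0 = if i ≤ g.length then none else mark := by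
      simp [hs₂, hs₁, hs.seen]
    rw [hseen]
    split_ifs with hle
    · have hlt : i < g.length := by omega
      refine base _ rfl ?_
      have hgi : g[i]? = some y := by
        rw [hxg i hlt] at hxi
        simpa using hxi
      simp only [Cmd.exec, hs₂, hs₁, Store.put_out, hs.out, List.take_add_one, hgi]
      simp
    · refine base _ rfl ?_
      simp only [Cmd.exec, hs₂, hs₁, Store.put_out, hs.out]
      rw [List.take_of_length_le (by omega), List.take_of_length_le (by omega)]

end Setup

end ClosestElement

namespace ClosestElement

open Function ACmd

variable {L : Type}

/-! ### The complete algorithm. -/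

/-- The algorithm for the closest element problem: fold the graph that consists of a path for the
first word and of loops for the other words, find a shortest path from the end of the first word
to the base vertex, and write the first word and the label of this path. -/
def algorithm [DecidableEq L] (inv : L → L) : ACmd L :=
  .seq (setup inv) <| .seq foldAll <| .seq layers outputWord

/-- Arrays and machines disappear from here on: what remains is a graph, its least folding relation,
and an output `g ++ u` with `u` a shortest label. The path in the hypothesis must have fewer than
`n` letters because `outputWord` inspects only the layers below `n`. -/
theorem algorithm_spec [DecidableEq L] (inv : L → L) {x : List (Option L)} {g : List L}
    {rest : List (Option L)} (hx : x = g.map some ++ none :: rest) {n : ℕ}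
    (hn : n = x.length + 1) :
    ∃ (ed : ℕ → ℕ → Sym L) (E : ℕ → ℕ → Prop),
      (∀ p < n, ∀ q < n, ∀ y, ed p q = letter y ↔ IsEdge inv x n p q y) ∧
      FoldClosed n ed E ∧
      (∀ p < n, ∀ q < n, Linked x g.length n p q → E p q) ∧
      (∀ T, FoldClosed n ed T → (∀ p < n, ∀ q < n, Linked x g.length n p q → T p q) →
        ∀ p < n, ∀ q < n, E p q → T p q) ∧
      ((∃ u, Reach n ed E g.length u 0 ∧ u.length < n) →
        ∃ u, Reach n ed E g.length u 0 ∧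
          ((algorithm inv).exec n (fun _ => 0) (.init .inp (x.map some))).out =
            (g ++ u).reverse.map letter ∧
          ∀ u', Reach n ed E g.length u' 0 → u.length ≤ u'.length) := by
  have hgn : g.length + 2 ≤ n := by
    rw [hn, hx]
    simp
  have h1 := setup_spec inv hx hn
  set s₁ := (setup inv).exec n (fun _ => 0) (.init .inp (x.map some)) with hs₁
  obtain ⟨h2, h3⟩ := foldAll_spec (n := n) (by omega) s₁
  set s₂ := foldAll.exec n (fun _ => 0) s₁ with hs₂
  have hstart : ∀ p < n, s₂.arr .start p = mark ↔ p = g.length := by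
    intro p hp
    rw [h2.arr _ (by simp), h1.start]
    exact ⟨fun h => h.1, fun h => ⟨h, hp⟩⟩
  obtain ⟨h4, h5, h6, h7⟩ := layers_spec (n := n) (e := g.length) (by omega) hstart
    (by rw [h2.arr _ (by simp), h1.layer]) (by rw [h2.arr _ (by simp), h1.word])
  set s₃ := layers.exec n (fun _ => 0) s₂ with hs₃
  have hedge : s₂.tab n .edge = s₁.tab n .edge := h2.tab (by simp)
  refine ⟨s₂.tab n .edge, fun p q => s₂.tab n .fold p q = mark, fun p hp q hq y => ?_, h3,
    fun p hp q hq h => ?_, fun T hT h => ?_, ?_⟩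
  · rw [hedge]
    exact h1.edge p hp q hq y
  · exact h2.mono p hp q hq ((h1.fold p hp q hq).2 h)
  · rw [hedge] at hT
    exact h2.sound T hT fun p hp q hq hpq => h p hp q hq ((h1.fold p hp q hq).1 hpq)
  · rintro ⟨u₀, hu₀, hlen₀⟩
    have hm₀ := h7 u₀ 0 hu₀ hlen₀.le
    obtain ⟨u, hu, hout, hmin⟩ := outputWord_spec h6
      (by rw [h4 _ (by simp) (by simp), h2.arr _ (by simp), h1.done]) ⟨_, hlen₀, hm₀⟩
    have hlen : u.length ≤ u₀.length := not_lt.1 fun h => hmin _ h hm₀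
    refine ⟨u, hu, ?_, fun u' hu' => not_lt.1 fun h => hmin _ h (h7 u' 0 hu' (by omega))⟩
    change (outputWord.exec n (fun _ => 0) s₃).out = _
    rw [hout, h5, h2.out, h1.out, List.take_of_length_le (by omega), List.reverse_append,
      List.map_append]

/-! ### Paths in the folded graph -/

namespace Reach

variable {n : ℕ} {ed : ℕ → ℕ → Sym L} {E : ℕ → ℕ → Prop} {a b c : ℕ} {u v : List L}

theorem extend (hE : FoldClosed n ed E) (ha : a < n) (h : Reach n ed E a u b) (hc : c < n)
    (hbc : E b c) : Reach n ed E a u c := by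
  cases h with
  | nil hb hab => exact .nil hc (hE.trans a ha b hb c hc hab hbc)
  | snoc h hq hy hb hqb => exact .snoc h hq hy hc (hE.trans _ hq b hb c hc hqb hbc)

theorem trans (hE : FoldClosed n ed E) (ha : a < n) (h : Reach n ed E a u b)
    (h' : Reach n ed E b v c) : Reach n ed E a (u ++ v) c := by
  induction h' with
  | nil hc hbc =>
    rw [List.append_nil]
    exact h.extend hE ha hc hbc
  | snoc _ hq hy hr hqr ih =>
    rw [← List.append_assoc]
    exact .snoc ih hq hy hr hqr

theorem snoc_inv {y : L} (h : Reach n ed E a (u ++ [y]) c) :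
    ∃ p q, Reach n ed E a u p ∧ q < n ∧ ed p q = letter y ∧ c < n ∧ E q c := by
  generalize hw : u ++ [y] = w at h
  cases h with
  | nil => simp at hw
  | snoc h hq hy hr hqr =>
    obtain ⟨rfl, h2⟩ := List.append_inj' hw rfl
    obtain rfl : y = _ := by simpa using h2
    exact ⟨_, _, h, hq, hy, hr, hqr⟩

theorem split (hrefl : ∀ p < n, E p p) :
    ∀ {c : ℕ}, Reach n ed E a (u ++ v) c → ∃ m, Reach n ed E a u m ∧ Reach n ed E m v c := by
  induction v using List.reverseRecOn with
  | nil =>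
    intro c h
    rw [List.append_nil] at h
    exact ⟨c, h, .nil h.lt (hrefl c h.lt)⟩
  | append_singleton v y ih =>
    intro c h
    rw [← List.append_assoc] at h
    obtain ⟨p, q, h1, hq, hy, hc, hqc⟩ := h.snoc_inv
    obtain ⟨m, h2, h3⟩ := ih h1
    exact ⟨m, h2, .snoc h3 hq hy hc hqc⟩

/-- After reading `y` and then its inverse in a folded graph one is back at a related vertex, so the
two edges can be replaced by a single passage along `E`. -/
theorem cancel (hE : FoldClosed n ed E) (hrefl : ∀ p < n, E p p) {inv : L → L}
    (hinv : ∀ p < n, ∀ q < n, ∀ y, ed p q = letter y → ed q p = letter (inv y)) {y : L}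
    (ha : a < n) (h : Reach n ed E a (u ++ y :: inv y :: v) c) : Reach n ed E a (u ++ v) c := by
  obtain ⟨m, h1, h2⟩ := split hrefl h
  have e : y :: inv y :: v = ([y] ++ [inv y]) ++ v := rfl
  rw [e] at h2
  obtain ⟨m', h3, h4⟩ := split hrefl h2
  obtain ⟨p₁, q₁, h5, hq₁, hy₁, hm', hE₁⟩ := h3.snoc_inv
  obtain ⟨p₀, q₀, h6, hq₀, hy₀, hp₁, hE₀⟩ := snoc_inv (u := []) h5
  obtain ⟨hp₀, hmp₀⟩ : p₀ < n ∧ E m p₀ := by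
    generalize hw : ([] : List L) = w at h6
    cases h6 with
    | nil hp h => exact ⟨hp, h⟩
    | snoc => simp at hw
  have hm := h1.lt
  -- Folding is applied to the first edge reversed and to the second edge: both carry `inv y`, and
  -- their origins `q₀` and `p₁` are related.
  have h7 : E p₀ q₁ := hE.fold q₀ hq₀ p₀ hp₀ p₁ hp₁ q₁ hq₁ (inv y) (hinv _ hp₀ _ hq₀ _ hy₀) hy₁ hE₀
  have h8 : E m m' := hE.trans m hm p₀ hp₀ m' hm' hmp₀ (hE.trans p₀ hp₀ q₁ hq₁ m' hm' h7 hE₁)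
  exact (h1.extend hE ha hm' h8).trans hE ha h4

theorem reverse (hE : FoldClosed n ed E) (hrefl : ∀ p < n, E p p)
    (hsymm : ∀ p < n, ∀ q < n, E p q → E q p) {inv : L → L}
    (hinv : ∀ p < n, ∀ q < n, ∀ y, ed p q = letter y → ed q p = letter (inv y))
    (ha : a < n) (h : Reach n ed E a u b) : Reach n ed E b (u.map inv).reverse a := by
  induction h with
  | nil hb hab => exact .nil ha (hsymm a ha _ hb hab)
  | snoc h hq hy hr hqr ih =>
    rw [List.map_append, List.reverse_append]
    have h1 : Reach n ed E _ [] _ := .nil hq (hsymm _ hq _ hr hqr)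
    have h2 := Reach.snoc h1 h.lt (hinv _ h.lt _ hq _ hy) h.lt (hrefl _ h.lt)
    exact h2.trans hE hr ih

end Reach

end ClosestElement

namespace ClosestElement

open Function ACmd

/-! ### The folded graph of an input -/

section Folded

variable {L : Type} {inv : L → L} {x : List (Option L)} {e n : ℕ} {ed : ℕ → ℕ → Sym L}
  {E : ℕ → ℕ → Prop}

/-- `ed` is the edge relation of the graph of the input `x`, and `E` is the least relation that
contains the initial identifications and is closed under folding. -/
structure IsFolded (inv : L → L) (x : List (Option L)) (e n : ℕ) (ed : ℕ → ℕ → Sym L)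
    (E : ℕ → ℕ → Prop) : Prop where
  edge : ∀ p < n, ∀ q < n, ∀ y, ed p q = letter y ↔ IsEdge inv x n p q y
  closed : FoldClosed n ed E
  linked : ∀ p < n, ∀ q < n, Linked x e n p q → E p q
  minimal : ∀ T, FoldClosed n ed T → (∀ p < n, ∀ q < n, Linked x e n p q → T p q) →
    ∀ p < n, ∀ q < n, E p q → T p q

theorem Linked.symm {p q : ℕ} (h : Linked x e n p q) : Linked x e n q p := by
  rcases h with ⟨rfl, h⟩ | h | h
  · exact .inl ⟨rfl, h⟩
  · exact .inr (.inr h)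
  · exact .inr (.inl h)

namespace IsFolded

theorem refl (h : IsFolded inv x e n ed E) : ∀ p < n, E p p :=
  fun p hp => h.linked p hp p hp (.inl ⟨rfl, hp⟩)

/-- Symmetry is not part of `FoldClosed`. It follows from minimality, since the opposite relation is
closed too and the initial identifications are symmetric. -/
theorem symm (h : IsFolded inv x e n ed E) : ∀ p < n, ∀ q < n, E p q → E q p := by
  refine h.minimal (fun p q => E q p) ⟨fun p hp q hq r hr a b => ?_,
    fun p hp p' hp' q hq q' hq' y a b c => ?_⟩ fun p hp q hq hl => h.linked q hq p hp hl.symm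
  · exact h.closed.trans r hr q hq p hp b a
  · exact h.closed.fold q hq q' hq' p hp p' hp' y b a c

theorem edge_inv (h : IsFolded inv x e n ed E) (hi : Involutive inv) :
    ∀ p < n, ∀ q < n, ∀ y, ed p q = letter y → ed q p = letter (inv y) := by
  intro p hp q hq y hy
  rw [h.edge p hp q hq] at hy
  rw [h.edge q hq p hp]
  rcases hy with ⟨h1, h2, h3⟩ | ⟨h1, h2, z, h3, h4⟩
  · exact .inr ⟨h1, h2, y, h3, rfl⟩
  · refine .inl ⟨h1, h2, ?_⟩
    rw [h3, ← h4, hi z]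

theorem reach_straight (h : IsFolded inv x e n ed E) (hn : n = x.length + 1)
    {pre : List (Option L)} (w : List L) :
    ∀ {post : List (Option L)}, x = pre ++ (w.map some ++ post) →
      Reach n ed E pre.length w (pre.length + w.length) := by
  induction w using List.reverseRecOn with
  | nil =>
    intro post hx
    have : pre.length < n := by
      rw [hn, hx]
      simp only [List.length_append]
      omega
    exact .nil this (h.refl _ this)
  | append_singleton w y ih =>
    intro post hx
    have hx' : x = pre ++ (w.map some ++ some y :: post) := by simpa using hx
    have hl : pre.length + w.length + 1 < n := by
      rw [hn, hx']
      simp only [List.length_append, List.length_cons, List.length_map]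
      omega
    have hy : ed (pre.length + w.length) (pre.length + w.length + 1) = letter y := by
      rw [h.edge _ (by omega) _ hl]
      refine .inl ⟨rfl, by omega, ?_⟩
      rw [hx', ← List.append_assoc, List.getElem?_append_right (by simp)]
      simp
    have := Reach.snoc (ih hx') hl hy hl (h.refl _ hl)
    rwa [List.length_append, List.length_singleton, ← Nat.add_assoc]

/-- A word between two separators is the label of a loop at the base vertex. -/
theorem reach_loop (h : IsFolded inv x e n ed E) (hn : n = x.length + 1) {pre post : List (Option L)}
    {w : List L} (hx : x = pre ++ none :: (w.map some ++ none :: post)) (he : e ≤ pre.length) :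
    Reach n ed E 0 w 0 := by
  have hx' : x = (pre ++ [none]) ++ (w.map some ++ none :: post) := by simpa using hx
  have hl : pre.length + 1 + w.length + 1 < n := by
    rw [hn, hx']
    simp only [List.length_append, List.length_cons, List.length_map, List.length_nil]
    omega
  have h1 := h.reach_straight hn w hx'
  rw [List.length_append, List.length_singleton] at h1
  have h0 : 0 < n := by omega
  have h2 : E 0 (pre.length + 1) := by
    refine h.linked _ h0 _ (by omega) (.inr (.inr ⟨rfl, .inr ⟨_, rfl, by omega, ?_⟩⟩))
    rw [hx, List.getElem?_append_right le_rfl]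
    simp
  -- The bound `e ≤ pre.length` ensures that this end is not that of the first word, which is not
  -- identified with the base vertex.
  have h3 : E (pre.length + 1 + w.length) 0 := by
    refine h.linked _ (by omega) _ h0 (.inr (.inl ⟨rfl, .inl ⟨by omega, ?_, by omega⟩⟩))
    have hlen : pre.length + 1 + w.length = (pre ++ [none] ++ w.map some).length := by simp; omega
    rw [hx', ← List.append_assoc, hlen, List.getElem?_append_right le_rfl]
    simp
  have h4 : Reach n ed E 0 [] (pre.length + 1) := .nil (by omega) h2
  exact (h4.trans h.closed h0 h1).extend h.closed h0 h0 h3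

end IsFolded

end Folded

/-! ### Generators as loops, and values in the group. -/

section Encode

variable {A : Type}

theorem Instance.encode_eq (I : Instance A) : I.encode =
    I.elt.map some ++ none :: I.gens.flatMap fun w => w.map some ++ [none] := by
  simp [Instance.encode]

theorem IsFolded.reach_gen {inv : A × Bool → A × Bool} {x : List (Option (A × Bool))} {e n : ℕ}
    {ed : ℕ → ℕ → Sym (A × Bool)} {E : ℕ → ℕ → Prop} (h : IsFolded inv x e n ed E)
    (hn : n = x.length + 1) {w : Word A} (ws : List (Word A)) :
    ∀ {pre : List (Option (A × Bool))},
      x = pre ++ none :: ws.flatMap (fun w => w.map some ++ [none]) → e ≤ pre.length → w ∈ ws →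
      Reach n ed E 0 w 0 := by
  induction ws with
  | nil => simp
  | cons v ws ih =>
    intro pre hx he hw
    have hx' : x = pre ++ none :: (v.map some ++ none ::
        ws.flatMap (fun w => w.map some ++ [none])) := by simpa using hx
    rcases List.mem_cons.1 hw with rfl | hw
    · exact h.reach_loop hn hx' he
    · refine ih (pre := pre ++ none :: v.map some) (by simpa using hx') ?_ hw
      rw [List.length_append]
      omega

/-- The inverse of a letter. -/
def letterInv (y : A × Bool) : A × Bool := (y.1, !y.2)

theorem letterInv_involutive : Involutive (letterInv (A := A)) := fun y => by
  simp [letterInv]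

variable {G : Type*} [Group G]

/-- The element of the group that is represented by a letter. -/
def letterVal (x : A → G) (y : A × Bool) : G := if y.2 then x y.1 else (x y.1)⁻¹

theorem letterVal_inv (x : A → G) (y : A × Bool) : letterVal x (letterInv y) = (letterVal x y)⁻¹ := by
  rcases y with ⟨a, _ | _⟩ <;> simp [letterVal, letterInv]

theorem eval_nil (x : A → G) : eval x [] = 1 := rfl

theorem eval_append (x : A → G) (u v : Word A) : eval x (u ++ v) = eval x u * eval x v := by
  simp [eval]

theorem eval_singleton (x : A → G) (y : A × Bool) : eval x [y] = letterVal x y := by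
  simp [eval, letterVal]

theorem eval_inv (x : A → G) (w : Word A) : eval x (w.map letterInv).reverse = (eval x w)⁻¹ := by
  induction w with
  | nil => simp [eval_nil]
  | cons y w ih =>
    rw [List.map_cons, List.reverse_cons, eval_append, ih, eval_singleton, letterVal_inv,
      ← mul_inv_rev, ← eval_singleton, ← eval_append, List.singleton_append]

/-! ### Soundness -/

/-- The element of the group that is represented by the part of the input after the last
separator. -/
def lastVal (x : A → G) (l : List (Option (A × Bool))) : G :=
  l.foldl (fun a o => o.elim 1 fun y => a * letterVal x y) 1

theorem lastVal_map (x : A → G) (w : Word A) : lastVal x (w.map some) = eval x w := by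
  induction w using List.reverseRecOn with
  | nil => rfl
  | append_singleton w y ih =>
    rw [eval_append, ← ih, eval_singleton]
    simp [lastVal]

theorem lastVal_append_none (x : A → G) (l l' : List (Option (A × Bool))) :
    lastVal x (l ++ none :: l') = lastVal x l' := by
  simp [lastVal]

theorem lastVal_take_succ (x : A → G) {l : List (Option (A × Bool))} {p : ℕ}
    {o : Option (A × Bool)} (h : l[p]? = some o) : lastVal x (l.take (p + 1)) =
      o.elim 1 fun y => lastVal x (l.take p) * letterVal x y := by
  rw [List.take_add_one, h]
  simp [lastVal]

theorem getElem?_append_none {L : Type} {w : List L} {l : List (Option L)} {p : ℕ}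
    (h : (w.map some ++ none :: l)[p]? = some none) :
    p = w.length ∨ ∃ k, p = w.length + 1 + k ∧ l[k]? = some none := by
  rcases lt_trichotomy p w.length with hp | hp | hp
  · rw [List.getElem?_append_left (by simpa using hp)] at h
    simp [List.getElem?_map] at h
  · exact .inl hp
  · obtain ⟨k, rfl⟩ := Nat.exists_eq_add_of_lt hp
    refine .inr ⟨k, by omega, ?_⟩
    rw [List.getElem?_append_right (by simp; omega)] at h
    have : w.length + k + 1 - (w.map some).length = k + 1 := by simp; omega
    rw [this] at h
    simpa using h

theorem lastVal_take_add (x : A → G) (w : Word A) (l : List (Option (A × Bool))) (k : ℕ) :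
    lastVal x ((w.map some ++ none :: l).take (w.length + 1 + k)) = lastVal x (l.take k) := by
  have : w.length + 1 + k = (w.map some).length + (k + 1) := by simp; omega
  rw [this, List.take_length_add_append, List.take_succ_cons, lastVal_append_none]

/-- At a separator the value accumulated so far is that of the word it ends. This puts the ends of
the generator words in `H`. -/
theorem lastVal_separator (x : A → G) (ws : List (Word A)) : ∀ {p : ℕ},
    (ws.flatMap fun w => w.map some ++ [none])[p]? = some none →
    ∃ w ∈ ws, lastVal x ((ws.flatMap fun w => w.map some ++ [none]).take p) = eval x w := by
  induction ws with
  | nil => simp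
  | cons v ws ih =>
    intro p hp
    have e : ((v :: ws).flatMap fun w => w.map some ++ [none]) =
      v.map some ++ none :: ws.flatMap fun w => w.map some ++ [none] := by simp
    rw [e] at hp ⊢
    rcases getElem?_append_none hp with rfl | ⟨k, rfl, hk⟩
    · refine ⟨v, by simp, ?_⟩
      rw [List.take_left' (by simp), lastVal_map]
    · obtain ⟨w, hw, h⟩ := ih hk
      exact ⟨w, by simp [hw], by rw [lastVal_take_add, h]⟩

variable {I : Instance A} {n : ℕ} {ed : ℕ → ℕ → Sym (A × Bool)} {E : ℕ → ℕ → Prop}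

theorem IsFolded.lastVal_edge (h : IsFolded letterInv I.encode I.elt.length n ed E) (x : A → G)
    {p q : ℕ} {y : A × Bool} (hp : p < n) (hq : q < n) (hy : ed p q = letter y) :
    lastVal x (I.encode.take q) = lastVal x (I.encode.take p) * letterVal x y := by
  rw [h.edge p hp q hq] at hy
  rcases hy with ⟨rfl, -, h3⟩ | ⟨rfl, -, z, h3, rfl⟩
  · simp [lastVal_take_succ x h3]
  · simp [lastVal_take_succ x h3, letterVal_inv]

/-- Lying in the same right coset of `H` is a relation closed under folding, because equal labels
multiply both values on the right and cancel. It contains the initial identifications, so minimality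
of `E` applies. Freeness plays no role. -/
theorem IsFolded.mul_inv_mem (h : IsFolded letterInv I.encode I.elt.length n ed E) (x : A → G) :
    ∀ p < n, ∀ q < n, E p q →
      lastVal x (I.encode.take p) * (lastVal x (I.encode.take q))⁻¹ ∈ I.subgroup x := by
  have base : ∀ p, IsBase I.encode I.elt.length n p →
      lastVal x (I.encode.take p) ∈ I.subgroup x := by
    rintro p (⟨-, h2, h3⟩ | ⟨p', rfl, -, h2⟩)
    · rw [I.encode_eq] at h2 ⊢
      rcases getElem?_append_none h2 with h4 | ⟨k, rfl, hk⟩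
      · exact absurd h4 h3
      · obtain ⟨w, hw, e⟩ := lastVal_separator x I.gens hk
        rw [lastVal_take_add, e]
        exact Subgroup.subset_closure ⟨w, hw, rfl⟩
    · rw [lastVal_take_succ x h2]
      exact one_mem _
  refine h.minimal (fun p q => lastVal x (I.encode.take p) * (lastVal x (I.encode.take q))⁻¹ ∈
    I.subgroup x) ⟨fun p _ q _ r _ a b => ?_, fun p hp p' hp' q hq q' hq' y a b c => ?_⟩ ?_
  · have := mul_mem a b
    rwa [mul_assoc, inv_mul_cancel_left] at this
  · rw [h.lastVal_edge x hp hp' a, h.lastVal_edge x hq hq' b]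
    simpa [mul_assoc] using c
  · rintro p - q - (⟨rfl, -⟩ | ⟨rfl, hb⟩ | ⟨rfl, hb⟩)
    · simp
    · simpa [lastVal] using base p hb
    · simpa [lastVal] using base q hb

theorem IsFolded.mul_eval_mem (h : IsFolded letterInv I.encode I.elt.length n ed E) (x : A → G)
    {a p : ℕ} {u : Word A} (ha : a < n) (hu : Reach n ed E a u p) :
    lastVal x (I.encode.take a) * eval x u * (lastVal x (I.encode.take p))⁻¹ ∈ I.subgroup x := by
  induction hu with
  | nil hp hE => simpa [eval_nil] using h.mul_inv_mem x _ ha _ hp hE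
  | snoc hu hq hy hr hE ih =>
    have := mul_mem ih (h.mul_inv_mem x _ hq _ hr hE)
    rw [h.lastVal_edge x hu.lt hq hy] at this
    rw [eval_append, eval_singleton]
    simpa [mul_assoc] using this

/-! ### Completeness -/

/-- Labels of loops at the base vertex include the generators and are stable under concatenation and
formal inversion, so their values exhaust the subgroup. -/
theorem IsFolded.exists_reach (h : IsFolded letterInv I.encode I.elt.length n ed E)
    (hn : n = I.encode.length + 1) (x : A → G) {g : G} (hg : g ∈ I.subgroup x) :
    ∃ w, Reach n ed E 0 w 0 ∧ eval x w = g := by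
  have h0 : 0 < n := by omega
  induction hg using Subgroup.closure_induction with
  | mem g hg =>
    obtain ⟨w, hw, rfl⟩ := hg
    refine ⟨w, h.reach_gen hn I.gens I.encode_eq ?_ hw, rfl⟩
    simp
  | one => exact ⟨[], .nil h0 (h.refl 0 h0), rfl⟩
  | mul a b _ _ ha hb =>
    obtain ⟨u, hu, rfl⟩ := ha
    obtain ⟨v, hv, rfl⟩ := hb
    exact ⟨u ++ v, hu.trans h.closed h0 hv, eval_append _ _ _⟩
  | inv a _ ha =>
    obtain ⟨u, hu, rfl⟩ := ha
    exact ⟨_, hu.reverse h.closed h.refl h.symm (h.edge_inv letterInv_involutive) h0,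
      eval_inv _ _⟩

theorem IsFolded.reach_red (h : IsFolded letterInv I.encode I.elt.length n ed E) {a c : ℕ}
    (ha : a < n) {u v : Word A} (huv : FreeGroup.Red u v) (hu : Reach n ed E a u c) :
    Reach n ed E a v c := by
  induction huv with
  | refl => exact hu
  | tail _ hs ih =>
    cases hs with
    | not => exact Reach.cancel h.closed h.refl (h.edge_inv letterInv_involutive) ha ih

end Encode

/-! ### Word length in a free group -/

section Free

variable {A : Type} {G : Type*} [Group G] (b : FreeGroupBasis A G)

theorem repr_eval (w : Word A) : b.repr (eval (fun i => b i) w) = FreeGroup.mk w := by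
  induction w with
  | nil => simp [eval_nil, FreeGroup.one_eq_mk]
  | cons y w ih =>
    rw [← List.singleton_append, eval_append, map_mul, ih, ← FreeGroup.mul_mk, eval_singleton]
    congr 1
    rcases y with ⟨a, _ | _⟩
    · simp [letterVal, FreeGroup.of, FreeGroup.inv_mk, FreeGroup.invRev]
    · simp [letterVal, FreeGroup.of]

theorem wordLength_eval_le (w : Word A) :
    wordLength (fun i => b i) (eval (fun i => b i) w) ≤ w.length :=
  Nat.sInf_le ⟨w, rfl, rfl⟩

/-- Here freeness enters: two words with the same value in `G` are equal in the free group, hence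
have the same reduced form, and reduction does not lengthen a word. -/
theorem length_reduce_le_wordLength [DecidableEq A] (w : Word A) :
    (FreeGroup.reduce w).length ≤ wordLength (fun i => b i) (eval (fun i => b i) w) := by
  obtain ⟨v, hv, hl⟩ := Nat.sInf_mem
    (⟨w.length, w, rfl, rfl⟩ : {n | ∃ v : Word A, eval (fun i => b i) v =
      eval (fun i => b i) w ∧ v.length = n}.Nonempty)
  have h1 : FreeGroup.mk v = FreeGroup.mk w := by rw [← repr_eval b, ← repr_eval b, hv]
  rw [wordLength, ← hl, ← FreeGroup.toWord_mk, ← h1]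
  exact FreeGroup.norm_mk_le

theorem algorithm_isSolution [DecidableEq A] (I : Instance A) :
    ∃ w : Word A, ((algorithm letterInv).exec (I.encode.length + 1) (fun _ => 0)
        (.init .inp (I.encode.map some))).out = w.reverse.map letter ∧
      IsSolution (fun i => b i) I w := by
  obtain ⟨ed, E, h1, h2, h3, h4, h5⟩ := algorithm_spec letterInv I.encode_eq rfl
  have h : IsFolded letterInv I.encode I.elt.length (I.encode.length + 1) ed E := ⟨h1, h2, h3, h4⟩
  have hl : I.elt.length < I.encode.length + 1 := by
    rw [I.encode_eq, List.length_append, List.length_map]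
    omega
  -- Walking the path of the first word backwards gives a path of length below `n`, which guarantees
  -- that the search succeeds.
  have hg : Reach (I.encode.length + 1) ed E I.elt.length (I.elt.map letterInv).reverse 0 := by
    have := h.reach_straight rfl (pre := []) I.elt I.encode_eq
    rw [List.length_nil, Nat.zero_add] at this
    exact this.reverse h.closed h.refl h.symm (h.edge_inv letterInv_involutive) (by omega)
  obtain ⟨u, hu, hout, hmin⟩ := h5 ⟨_, hg, by simpa using hl⟩
  refine ⟨I.elt ++ u, hout, ?_, fun g hg' => ?_⟩
  · have := h.mul_eval_mem (fun i => b i) hl hu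
    rw [I.encode_eq, List.take_left' (by simp), lastVal_map, ← eval_append] at this
    simpa [lastVal] using this
  · obtain ⟨w, hw, rfl⟩ := h.exists_reach rfl (fun i => b i) hg'
    -- The competitor is the reduced form of `g⁻¹ w`; the length of that form is at most the
    -- distance from `g` to the value of `w`.
    have h6 := hmin _ (h.reach_red hl FreeGroup.reduce.red (hg.trans h.closed hl hw))
    rw [wordDist, wordDist, eval_append, inv_mul_cancel_left, ← eval_inv, ← eval_append]
    exact (wordLength_eval_le b u).trans (h6.trans (length_reduce_le_wordLength b _))

end Free

end ClosestElement

/-- In a free group of finite rank, with the generators of a free basis, the closest element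
problem is solvable in polynomial time. -/
theorem mainTheorem8 {G : Type*} [Group G] (r : ℕ) (b : FreeGroupBasis (Fin r) G) :
    ClosestElement.SolvableInPolyTime (fun i => b i) := by
  choose f hf hsol using ClosestElement.algorithm_isSolution b
  refine ⟨f, ?_, hsol⟩
  exact ClosestElement.Cmd.computableInPolyTime _ f some ClosestElement.letter
    (fun _ _ h => Option.some_injective _ (Option.some_injective _ h))
    (ClosestElement.algorithm ClosestElement.letterInv) .inp hf
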